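/- There is an absolute constant $C$ such that for every $\varepsilon>0$ there is a deterministic multi-pass semi-streaming algorithm $A$ for maximizing a non-negative monotone submodular function $f\colon 2^{\mathcal N}\to\mathbb R_{\ge 0}$ subject to a matroid constraint $M=(\mathcal N,\mathcal I)$ with the following properties. $A$ makes at most $C/\varepsilon^3$ passes over the input stream. On every instance $(f,M)$ with finite ground set $\mathcal N$, and for every order in which the elements of $\mathcal N$ appear in the stream, $A$ stores at most $C\,k/\varepsilon^3$ elements at any time, where $k$ is the rank of $M$ (the maximum size of an independent set), and it outputs a set $S\in\mathcal I$ of stored elements such that $$f(S)\;\ge\;\Bigl(1-\frac1e-\varepsilon\Bigr)\max_{T\in\mathcal I} f(T).$$ Here a data stream algorithm reads the elements of $\mathcal N$ one at a time, in the order of the stream, once in each pass. Between two reads it retains only a list of stored elements and a bit string. It does not know $\mathcal N$, $f$, $M$, $|\mathcal N|$ or $k$ in advance, and it may access $f$ and $M$ only through a value oracle and an independence oracle, queried on sets of elements that are stored or have just been read. Its space at a given time is the number of stored elements plus the number of retained bits; local computation between two reads is not charged. The algorithm is semi-streaming if its space is always $O(k\log^{O(1)}|\mathcal N|)$ (to be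 read with $k+1$ and $1+\log_2|\mathcal N|$ for $k=0$ and $|\mathcal N|\le 1$), where the constants may depend on $\varepsilon$. -/

import Mathlib

universe u

/-! ### The optimization problem -/

/-- An instance of monotone submodular maximization subject to a matroid constraint, over the
finite ground set `N`: a non-negative monotone submodular function `f` and a matroid `M` on `N`. -/
structure MSMMatroid (N : Type*) [Fintype N] [DecidableEq N] where
  /-- the objective function -/
  f : Finset N → ℝ
  /-- the matroid constraint -/
  M : Matroid N
  /-- the ground set of the matroid is the whole of `N` -/
  ground : M.E = Set.univ
  nonneg : ∀ S, 0 ≤ f S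
  monotone : ∀ S T, S ⊆ T → f S ≤ f T
  /-- diminishing returns: marginal contributions can only shrink when the set grows -/
  submodular : ∀ S T, S ⊆ T → ∀ u ∉ T, f (insert u T) - f T ≤ f (insert u S) - f S

/-- The rank of the matroid (finite, because the ground set is). -/
noncomputable def MSMMatroid.rank {N : Type*} [Fintype N] [DecidableEq N]
    (P : MSMMatroid N) : ℕ :=
  P.M.eRank.toNat

/-- `S` is feasible, and its value is at least `c` times the value of every feasible set. -/
def MSMMatroid.IsApprox {N : Type*} [Fintype N] [DecidableEq N]
    (P : MSMMatroid N) (c : ℝ) (S : Finset N) : Prop :=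
  P.M.Indep (S : Set N) ∧ ∀ T : Finset N, P.M.Indep (T : Set N) → c * P.f T ≤ P.f S

/-- An input stream: all the elements of the ground set, each of them once, in some order. -/
def IsStream {N : Type*} (σ : List N) : Prop :=
  σ.Nodup ∧ ∀ u : N, u ∈ σ

/-! ### The data stream model -/

/-- Everything that an algorithm can learn about the instance while `m` elements are accessible to
it (numbered by `Fin m`): which of these elements coincide, and the answers of the value oracle and
of the independence oracle, both of which accept only sets of accessible elements. -/
structure OracleView (m : ℕ) where
  same : Fin m → Fin m → Prop
  value : Finset (Fin m) → ℝ
  indep : Finset (Fin m) → Prop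

/-- The set of the elements standing at the positions `I` of the list `l`. -/
def elemsAt {N : Type*} [DecidableEq N] (l : List N) (I : Finset (Fin l.length)) : Finset N :=
  I.image l.get

/-- The access to the instance `P` that goes with the list `l` of accessible elements. -/
def MSMMatroid.view {N : Type*} [Fintype N] [DecidableEq N] (P : MSMMatroid N) (l : List N) :
    OracleView l.length where
  same i j := l.get i = l.get j
  value I := P.f (elemsAt l I)
  indep I := P.M.Indep (elemsAt l I : Set N)

/-- A deterministic data stream algorithm. Its description does not refer to any ground set,
instance or stream; in particular the rank and the number of elements are not known to it. Between
two reads it retains a bit string and a list of stored elements, and nothing else. -/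
structure StreamAlgorithm where
  /-- the number of passes over the stream -/
  passes : ℕ
  /-- the bits in memory at the start, when no element is stored -/
  init : List Bool
  /-- What is done when an element is read while `m` elements are stored. Position `0` of the view
  is the element just read, and position `i + 1` is the stored element number `i`. The result
  consists of the new bits and of the positions of the elements to be stored from now on. -/
  onElement : List Bool → (m : ℕ) → OracleView (m + 1) → List Bool × List (Fin (m + 1))
  /-- What is done when the end of the stream is reached, which completes a pass. -/
  onPassEnd : List Bool → (m : ℕ) → OracleView m → List Bool × List (Fin m)
  /-- The output after the last pass, a set of (positions of) stored elements. -/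
  output : List Bool → (m : ℕ) → OracleView m → Finset (Fin m)

/-- The memory content of an algorithm between two reads. -/
structure Memory (N : Type*) where
  bits : List Bool
  elems : List N

/-- The space used by a memory content: each bit and each stored element takes one unit. -/
def Memory.space {N : Type*} (μ : Memory N) : ℕ :=
  μ.elems.length + μ.bits.length

namespace StreamAlgorithm

/-- The successive reads of `A` on the stream `σ`: in every pass, the elements of `σ` in the order
of `σ` and then the end of the stream (`none`). -/
def reads {N : Type*} (A : StreamAlgorithm) (σ : List N) : List (Option N) :=
  (List.replicate A.passes (σ.map some ++ [none])).flatten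

variable {N : Type*} [Fintype N] [DecidableEq N]

/-- One read: the memory content is replaced by a new one. -/
def step (A : StreamAlgorithm) (P : MSMMatroid N) (μ : Memory N) : Option N → Memory N
  | some u =>
      let r := A.onElement μ.bits μ.elems.length (P.view (u :: μ.elems))
      ⟨r.1, r.2.map (u :: μ.elems).get⟩
  | none =>
      let r := A.onPassEnd μ.bits μ.elems.length (P.view μ.elems)
      ⟨r.1, r.2.map μ.elems.get⟩

/-- The memory content after the first `t` reads (after the last read if there are fewer). -/
def memoryAt (A : StreamAlgorithm) (P : MSMMatroid N) (σ : List N) (t : ℕ) : Memory N :=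
  ((A.reads σ).take t).foldl (A.step P) ⟨A.init, []⟩

/-- The memory content after the last read. -/
def finalMemory (A : StreamAlgorithm) (P : MSMMatroid N) (σ : List N) : Memory N :=
  (A.reads σ).foldl (A.step P) ⟨A.init, []⟩

/-- The set of elements that `A` outputs. -/
def result (A : StreamAlgorithm) (P : MSMMatroid N) (σ : List N) : Finset N :=
  let μ := A.finalMemory P σ
  elemsAt μ.elems (A.output μ.bits μ.elems.length (P.view μ.elems))

end StreamAlgorithm

/-- `A` is a semi-streaming algorithm: its space is `O(k · log^{O(1)} |N|)` on every instance with
a matroid of rank `k`. (The summands `1` only matter for `k = 0` and for `|N| ≤ 1`.) -/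
def StreamAlgorithm.IsSemiStreaming (A : StreamAlgorithm) : Prop :=
  ∃ K d : ℕ, ∀ (N : Type u) [Fintype N] [DecidableEq N] (P : MSMMatroid N) (σ : List N),
    IsStream σ → ∀ t : ℕ,
      (A.memoryAt P σ t).space ≤ K * (P.rank + 1) * (Nat.log 2 (Fintype.card N) + 1) ^ d

/-! Fix an integer `L` of order `1/ε` and put `p = 1/L`. One independent set is built in each of `L`
phases, and the stored lists are valued by the expectation of `f` on a random sublist that keeps
every entry independently with probability `p`. Local computation is free, so these expectations are
computed exactly. This is a continuous greedy method with `L` steps.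

Let `v = f(O)` for a feasible `O`, let `W` be the value before a phase, and `V₀`, `V` the values
before and after one of its passes. During a pass the solution `B` is improved by exchanges that
demand a gain by a factor `1 + p`. Let `A` collect everything that was in `B` during the pass. Every
element read stays spanned by those elements of `B` whose weight is at least its marginal over `A`,
up to that factor (`PassState.step`). A Hall argument (`Matroid.Indep.sum_le_sum_of_mem_closure`)
then bounds the marginals of `O` over `A` by the weights of `B`, which telescope to `(V - W) / p`.
The value of `A` is controlled by the gain `V - V₀`. Together (`PassState.le_of_indep`) this gives
`p v ≤ p V + (V - V₀) + (1 + p) (V - W)`. So either the pass gains more than `p² v`, which can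
happen only about `1/p²` times, or `p ((1 - p) v - V) ≤ (1 + p) (V - W)`. Hence `L²` passes per
phase shrink the distance to `(1 - p) v` by the factor `(1 + p) / (1 + 2p)`, and `L` phases by `1/e
+ O(p)`.

At the end, the expectation is at most the multilinear extension at an average of `L` bases, and
pipage rounding finds an independent set of stored elements worth at least as much
(`IsMonoSub.exists_indep_sampled_le`). Exhaustive search among the stored elements does no worse. -/

/-! ### Random subsets and expected values -/

/-- Monotone set functions with diminishing returns. -/
structure IsMonoSub {ι : Type*} [DecidableEq ι] (f : Finset ι → ℝ) : Prop where
  mono : ∀ S T, S ⊆ T → f S ≤ f T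
  sub : ∀ S T, S ⊆ T → ∀ u, f (insert u T) - f T ≤ f (insert u S) - f S

/-- The expectation of `f` after `u` is added to the argument with probability `p`. -/
def mix {ι : Type*} [DecidableEq ι] (p : ℝ) (u : ι) (f : Finset ι → ℝ) : Finset ι → ℝ :=
  fun T => p * f (insert u T) + (1 - p) * f T

/-- The expectation of `f` after each member of `l` is added to the argument with probability `p`,
independently. -/
def sampled {ι : Type*} [DecidableEq ι] (p : ℝ) (l : List ι) (f : Finset ι → ℝ) : Finset ι → ℝ :=
  l.foldr (mix p) f

/-- The expected marginal value of `u` with respect to a random subset of `l`. -/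
def marg {ι : Type*} [DecidableEq ι] (p : ℝ) (f : Finset ι → ℝ) (l : List ι) (u : ι) : ℝ :=
  sampled p l f {u} - sampled p l f ∅

section Mix

variable {ι : Type*} [DecidableEq ι] {p : ℝ} {f h : Finset ι → ℝ}

lemma MSMMatroid.isMonoSub {N : Type*} [Fintype N] [DecidableEq N] (P : MSMMatroid N) :
    IsMonoSub P.f := by
  refine ⟨P.monotone, fun S T hST u => ?_⟩
  by_cases hu : u ∈ T
  · rw [Finset.insert_eq_of_mem hu, sub_self]
    exact sub_nonneg.2 (P.monotone _ _ (Finset.subset_insert _ _))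
  · exact P.submodular S T hST u hu

lemma mix_mono_fun (h0 : 0 ≤ p) (h1 : p ≤ 1) (u : ι) (hfh : ∀ T, f T ≤ h T) (T : Finset ι) :
    mix p u f T ≤ mix p u h T := by
  have := mul_le_mul_of_nonneg_left (hfh (insert u T)) h0
  have := mul_le_mul_of_nonneg_left (hfh T) (sub_nonneg.2 h1)
  simp only [mix]; linarith

lemma IsMonoSub.after_mix (hf : IsMonoSub f) (h0 : 0 ≤ p) (h1 : p ≤ 1) (u : ι) :
    IsMonoSub (mix p u f) := by
  constructor
  · intro S T hST
    have := mul_le_mul_of_nonneg_left (hf.mono _ _ (Finset.insert_subset_insert u hST)) h0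
    have := mul_le_mul_of_nonneg_left (hf.mono _ _ hST) (sub_nonneg.2 h1)
    simp only [mix]; linarith
  · intro S T hST v
    have := mul_le_mul_of_nonneg_left (hf.sub _ _ (Finset.insert_subset_insert u hST) v) h0
    have := mul_le_mul_of_nonneg_left (hf.sub _ _ hST v) (sub_nonneg.2 h1)
    simp only [mix, Finset.insert_comm u v]; linarith

lemma mix_comm (p q : ℝ) (u v : ι) (f : Finset ι → ℝ) :
    mix p u (mix q v f) = mix q v (mix p u f) := by
  funext T; simp only [mix, Finset.insert_comm u v]; ring

@[simp] lemma sampled_nil : sampled p [] f = f := rfl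

@[simp] lemma sampled_cons (u : ι) (l : List ι) :
    sampled p (u :: l) f = mix p u (sampled p l f) := rfl

lemma sampled_append (l l' : List ι) :
    sampled p (l ++ l') f = sampled p l (sampled p l' f) := by
  simp [sampled, List.foldr_append]

lemma marg_append (l l' : List ι) (u : ι) :
    marg p f (l ++ l') u = marg p (sampled p l' f) l u := by
  simp [marg, sampled_append]

lemma IsMonoSub.after_sampled (hf : IsMonoSub f) (h0 : 0 ≤ p) (h1 : p ≤ 1) (l : List ι) :
    IsMonoSub (sampled p l f) := by
  induction l with
  | nil => exact hf
  | cons u l ih => exact ih.after_mix h0 h1 u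

lemma IsMonoSub.le_mix (hf : IsMonoSub f) (h0 : 0 ≤ p) (u : ι) (T : Finset ι) :
    f T ≤ mix p u f T := by
  have := mul_le_mul_of_nonneg_left (hf.mono _ _ (Finset.subset_insert u T)) h0
  simp only [mix]; linarith

lemma IsMonoSub.le_sampled (hf : IsMonoSub f) (h0 : 0 ≤ p) (h1 : p ≤ 1) (l : List ι)
    (T : Finset ι) : f T ≤ sampled p l f T := by
  induction l with
  | nil => exact le_rfl
  | cons u l ih => exact ih.trans ((hf.after_sampled h0 h1 l).le_mix h0 u T)

lemma sampled_cons_empty (u : ι) (l : List ι) :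
    sampled p (u :: l) f ∅ = sampled p l f ∅ + p * marg p f l u := by
  simp only [sampled_cons, mix, marg, insert_empty_eq]; ring

lemma IsMonoSub.marg_nonneg (hf : IsMonoSub f) (h0 : 0 ≤ p) (h1 : p ≤ 1) (l : List ι) (u : ι) :
    0 ≤ marg p f l u :=
  sub_nonneg.2 ((hf.after_sampled h0 h1 l).mono _ _ (Finset.empty_subset _))

/-- The discrete derivative of a set function. -/
def gain (u : ι) (f : Finset ι → ℝ) : Finset ι → ℝ := fun T => f (insert u T) - f T

lemma gain_mix (p : ℝ) (u v : ι) (f : Finset ι → ℝ) : gain u (mix p v f) = mix p v (gain u f) := by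
  funext T; simp only [mix, gain, Finset.insert_comm u v]; ring

lemma gain_sampled (p : ℝ) (u : ι) (l : List ι) (f : Finset ι → ℝ) :
    gain u (sampled p l f) = sampled p l (gain u f) := by
  induction l with
  | nil => rfl
  | cons v l ih => rw [sampled_cons, gain_mix, ih, sampled_cons]

/-- Sampling commutes with derivatives, so expected marginals are samples of a single antitone
function. -/
lemma marg_eq_sampled_gain (l : List ι) (u : ι) : marg p f l u = sampled p l (gain u f) ∅ := by
  rw [← gain_sampled]; simp [gain, marg]

lemma mix_antitone (h0 : 0 ≤ p) (h1 : p ≤ 1) (u : ι) (hh : ∀ S T, S ⊆ T → h T ≤ h S)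
    (S T : Finset ι) (hST : S ⊆ T) : mix p u h T ≤ mix p u h S := by
  have := mul_le_mul_of_nonneg_left (hh _ _ (Finset.insert_subset_insert u hST)) h0
  have := mul_le_mul_of_nonneg_left (hh _ _ hST) (sub_nonneg.2 h1)
  simp only [mix]; linarith

lemma sampled_antitone (h0 : 0 ≤ p) (h1 : p ≤ 1) (hh : ∀ S T, S ⊆ T → h T ≤ h S) (l : List ι) :
    ∀ S T, S ⊆ T → sampled p l h T ≤ sampled p l h S := by
  induction l with
  | nil => exact hh
  | cons u l ih => exact mix_antitone h0 h1 u ih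

lemma mix_le_of_antitone (h0 : 0 ≤ p) (u : ι) (hh : ∀ S T, S ⊆ T → h T ≤ h S)
    (T : Finset ι) : mix p u h T ≤ h T := by
  have := mul_le_mul_of_nonneg_left (hh _ _ (Finset.subset_insert u T)) h0
  simp only [mix]; linarith

/-- Passing to the longer list only makes further random insertions, and each of them can only lower
an antitone function. -/
lemma sampled_le_of_sublist (h0 : 0 ≤ p) (h1 : p ≤ 1) (hh : ∀ S T, S ⊆ T → h T ≤ h S)
    {l l' : List ι} (hl : l.Sublist l') : ∀ T, sampled p l' h T ≤ sampled p l h T := by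
  induction hl with
  | slnil => exact fun _ => le_rfl
  | cons u _ ih =>
    exact fun T => (mix_le_of_antitone h0 u (sampled_antitone h0 h1 hh _) T).trans (ih T)
  | cons_cons u _ ih => exact mix_mono_fun h0 h1 u ih

lemma IsMonoSub.marg_le_of_sublist (hf : IsMonoSub f) (h0 : 0 ≤ p) (h1 : p ≤ 1) {l l' : List ι}
    (hl : l.Sublist l') (u : ι) : marg p f l' u ≤ marg p f l u := by
  rw [marg_eq_sampled_gain, marg_eq_sampled_gain]
  exact sampled_le_of_sublist h0 h1 (fun S T hST => hf.sub S T hST u) hl ∅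

/-- Removing an element costs at most its marginal value at the time of its insertion. -/
lemma IsMonoSub.sampled_append_cons_le (hf : IsMonoSub f) (h0 : 0 ≤ p) (h1 : p ≤ 1)
    (l l' : List ι) (b : ι) :
    sampled p (l ++ b :: l') f ∅ ≤ sampled p (l ++ l') f ∅ + p * marg p f l' b := by
  -- Sampling is linear in the function, and `mix p b h` equals `h + p * gain b h`.
  have key : ∀ (l : List ι) (h : Finset ι → ℝ) (T : Finset ι), sampled p l (mix p b h) T =
      sampled p l h T + p * sampled p l (gain b h) T := by
    intro l h
    induction l with
    | nil => intro T; simp only [sampled_nil, mix, gain]; ring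
    | cons u l ih => intro T; simp only [sampled_cons, mix, ih] at *; ring
  have hanti : ∀ S T, S ⊆ T → gain b (sampled p l' f) T ≤ gain b (sampled p l' f) S :=
    fun S T hST => (hf.after_sampled h0 h1 l').sub S T hST b
  rw [sampled_append, sampled_append, sampled_cons, key]
  have := sampled_le_of_sublist h0 h1 hanti (List.nil_sublist l) ∅
  have h2 : gain b (sampled p l' f) ∅ = marg p f l' b := by simp [gain, marg]
  rw [sampled_nil, h2] at this
  have := mul_le_mul_of_nonneg_left this h0
  linarith

/-- The marginal values of the elements of `O` add up to at least the value gained by adding `O`. -/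
lemma IsMonoSub.le_add_sum_marg (hf : IsMonoSub f) (h0 : 0 ≤ p) (h1 : p ≤ 1) (l : List ι)
    (O : Finset ι) : f O ≤ sampled p l f ∅ + ∑ o ∈ O, marg p f l o := by
  refine (hf.le_sampled h0 h1 l O).trans ?_
  induction O using Finset.induction_on with
  | empty => simp
  | insert o O ho ih =>
    rw [Finset.sum_insert ho]
    have := (hf.after_sampled h0 h1 l).sub ∅ O (Finset.empty_subset _) o
    simp only [insert_empty_eq] at this
    simp only [marg] at *
    linarith

/-- The algorithm computes with positions, the analysis with elements. Several positions may hold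
the same element, so `e` need not be injective. -/
lemma sampled_comp_image {κ : Type*} [DecidableEq κ] (e : κ → ι) (l : List κ) (I : Finset κ) :
    sampled p l (fun J => f (J.image e)) I = sampled p (l.map e) f (I.image e) := by
  induction l generalizing I with
  | nil => rfl
  | cons u l ih => simp only [sampled_cons, List.map_cons, mix, ih, Finset.image_insert]

lemma marg_comp_image {κ : Type*} [DecidableEq κ] (e : κ → ι) (l : List κ) (u : κ) :
    marg p (fun J => f (J.image e)) l u = marg p f (l.map e) (e u) := by
  simp [marg, sampled_comp_image]

end Mix

/-! ### Matroids -/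

section Matroids

variable {N : Type*}

/-- If every `o` in an independent set `O` is spanned by the elements of `B` whose weight is at
least `c o`, then the total of `c` over `O` is at most the total weight of `B`. -/
lemma Matroid.Indep.sum_le_sum_of_mem_closure [DecidableEq N] {M : Matroid N} {O B : Finset N}
    (hO : M.Indep (O : Set N)) (c w : N → ℝ) (hw : ∀ b, 0 ≤ w b)
    (h : ∀ o ∈ O, o ∈ M.closure {b | b ∈ B ∧ c o ≤ w b}) :
    ∑ o ∈ O, c o ≤ ∑ b ∈ B, w b := by
  classical
  let t : O → Finset N := fun o => B.filter (fun b => c o ≤ w b)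
  -- Hall's condition: the neighbourhood of the member of `s` with the smallest `c` already spans
  -- all of `s`, hence has at least `s.card` elements.
  have hall : ∀ s : Finset O, s.card ≤ (s.biUnion t).card := by
    intro s
    rcases s.eq_empty_or_nonempty with rfl | hs
    · simp
    obtain ⟨o₀, ho₀, hmin⟩ := s.exists_min_image (fun o => c o) hs
    have hsub : ((s.map (Function.Embedding.subtype _) : Finset N) : Set N) ⊆
        M.closure (t o₀ : Set N) := by
      intro x hx
      simp only [Finset.coe_map, Set.mem_image, Finset.mem_coe] at hx
      obtain ⟨o, hos, rfl⟩ := hx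
      refine M.closure_subset_closure ?_ (h o.1 o.2)
      intro b hb
      simp only [t, Finset.coe_filter, Set.mem_ofPred_eq]
      exact ⟨hb.1, (hmin o hos).trans hb.2⟩
    have hind : M.Indep ((s.map (Function.Embedding.subtype _) : Finset N) : Set N) := by
      refine hO.subset ?_
      intro x hx
      simp only [Finset.coe_map, Set.mem_image, Finset.mem_coe] at hx
      obtain ⟨o, -, rfl⟩ := hx
      exact o.2
    have h1 := hind.encard_le_eRk_of_subset hsub
    rw [M.eRk_closure_eq] at h1
    have h2 := h1.trans (M.eRk_le_encard _)
    rw [Set.encard_coe_eq_coe_finsetCard, Set.encard_coe_eq_coe_finsetCard, Finset.card_map] at h2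
    have h3 : s.card ≤ (t o₀).card := by exact_mod_cast h2
    exact h3.trans (Finset.card_le_card (Finset.subset_biUnion_of_mem t ho₀))
  obtain ⟨φ, hφ, hφt⟩ := (Finset.all_card_le_biUnion_card_iff_exists_injective t).1 hall
  have hmem : ∀ o, φ o ∈ B ∧ c o ≤ w (φ o) := fun o => by simpa [t] using hφt o
  calc ∑ o ∈ O, c o = ∑ o : O, c o := (Finset.sum_coe_sort O c).symm
    _ ≤ ∑ o : O, w (φ o) := Finset.sum_le_sum fun o _ => (hmem o).2
    _ = ∑ b ∈ Finset.univ.image φ, w b := (Finset.sum_image fun a _ b _ hab => hφ hab).symm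
    _ ≤ ∑ b ∈ B, w b := by
        refine Finset.sum_le_sum_of_subset_of_nonneg ?_ fun b _ _ => hw b
        intro b hb
        obtain ⟨o, -, rfl⟩ := Finset.mem_image.1 hb
        exact (hmem o).1

/-- Symmetric exchange for bases. -/
lemma Matroid.IsBase.exists_symm_exchange {M : Matroid N} {B₁ B₂ : Set N} (h₁ : M.IsBase B₁)
    (h₂ : M.IsBase B₂) {b : N} (hb₁ : b ∈ B₁) (hb₂ : b ∉ B₂) :
    ∃ c ∈ B₂, c ∉ B₁ ∧ M.IsBase (insert c (B₁ \ {b})) ∧ M.IsBase (insert b (B₂ \ {c})) := by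
  have hbE : b ∈ M.E := h₁.subset_ground hb₁
  have hcl : b ∈ M.closure B₂ := h₂.closure_eq.symm ▸ hbE
  have hC := h₂.fundCircuit_isCircuit hbE hb₂
  have hbC := M.mem_fundCircuit b B₂
  have hnot : b ∉ M.closure (B₁ \ {b}) := h₁.indep.notMem_closure_sdiff_of_mem hb₁
  -- Otherwise the rest of the circuit, and with it `b`, would lie in the closure of `B₁ \ {b}`.
  have hex : ∃ c ∈ M.fundCircuit b B₂ \ {b}, c ∉ M.closure (B₁ \ {b}) := by
    by_contra! hcon
    exact hnot (M.closure_subset_closure_of_subset_closure hcon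
      (hC.mem_closure_sdiff_singleton_of_mem hbC))
  obtain ⟨c, ⟨hcC, hcb⟩, hc⟩ := hex
  have hcb' : c ≠ b := hcb
  have hcE : c ∈ M.E := hC.subset_ground hcC
  have hc₂ : c ∈ B₂ := by
    rcases M.fundCircuit_subset_insert b B₂ hcC with h | h
    · exact absurd h hcb
    · exact h
  have hc₁ : c ∉ B₁ := fun h =>
    hc (M.subset_closure (B₁ \ {b}) (Set.sdiff_subset.trans h₁.subset_ground) ⟨h, hcb⟩)
  refine ⟨c, hc₂, hc₁, ?_, ?_⟩
  · refine h₁.exchange_isBase_of_indep hc₁ ?_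
    exact ((h₁.indep.subset Set.sdiff_subset).insert_indep_iff).2 (Or.inl ⟨hcE, hc⟩)
  · refine h₂.exchange_isBase_of_indep hb₂ ?_
    have := (h₂.indep.mem_fundCircuit_iff hcl hb₂).1 hcC
    rwa [Set.insert_sdiff_of_notMem _ (by simpa using hcb'.symm)] at this

end Matroids

/-! ### Rounding -/

/-- The expectation of `f` after each member `u` of `l` is added to the argument with probability
`x u`; over a list of all elements, this is the multilinear extension of `f` at `x`. -/
def relaxed {ι : Type*} [DecidableEq ι] (x : ι → ℝ) (l : List ι) (f : Finset ι → ℝ) :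
    Finset ι → ℝ :=
  l.foldr (fun u h => mix (x u) u h) f

section Rounding

variable {N : Type*} [DecidableEq N] {f : Finset N → ℝ}

/-- Insertions commute, so the one or two coordinates under study can be moved to the front. -/
lemma relaxed_perm (x : N → ℝ) {l l' : List N} (h : l.Perm l') :
    relaxed x l f = relaxed x l' f :=
  haveI : LeftCommutative (fun (u : N) (h : Finset N → ℝ) => mix (x u) u h) :=
    ⟨fun _ _ _ => mix_comm _ _ _ _ _⟩
  h.foldr_eq f

lemma relaxed_cons (x : N → ℝ) (u : N) (l : List N) :
    relaxed x (u :: l) f = mix (x u) u (relaxed x l f) := rfl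

lemma relaxed_congr {x y : N → ℝ} {l : List N} (h : ∀ u ∈ l, x u = y u) :
    relaxed x l f = relaxed y l f := by
  induction l with
  | nil => rfl
  | cons u l ih =>
    rw [relaxed_cons, relaxed_cons, h u (by simp), ih fun v hv => h v (by simp [hv])]

lemma IsMonoSub.after_relaxed (hf : IsMonoSub f) {x : N → ℝ} (h0 : ∀ u, 0 ≤ x u)
    (h1 : ∀ u, x u ≤ 1) (l : List N) : IsMonoSub (relaxed x l f) := by
  induction l with
  | nil => exact hf
  | cons u l ih => exact ih.after_mix (h0 u) (h1 u) u

lemma IsMonoSub.mix_le_mix (hf : IsMonoSub f) {p q : ℝ} (hpq : p ≤ q) (u : N) (T : Finset N) :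
    mix p u f T ≤ mix q u f T := by
  have := mul_nonneg (sub_nonneg.2 hpq) (sub_nonneg.2 (hf.mono _ _ (Finset.subset_insert u T)))
  simp only [mix]; linarith

lemma IsMonoSub.relaxed_le_relaxed (hf : IsMonoSub f) {x y : N → ℝ} (h0 : ∀ u, 0 ≤ x u)
    (hxy : ∀ u, x u ≤ y u) (h1 : ∀ u, y u ≤ 1) (l : List N) (T : Finset N) :
    relaxed x l f T ≤ relaxed y l f T := by
  induction l generalizing T with
  | nil => exact le_rfl
  | cons u l ih =>
    exact (mix_mono_fun (h0 u) ((hxy u).trans (h1 u)) u ih T).trans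
      ((hf.after_relaxed (fun v => (h0 v).trans (hxy v)) h1 l).mix_le_mix (hxy u) u T)

lemma relaxed_zero (l : List N) : relaxed (fun _ => 0) l f = f := by
  induction l with
  | nil => rfl
  | cons u l ih => rw [relaxed_cons, ih]; funext T; simp [mix]

lemma IsMonoSub.relaxed_indicator_le (hf : IsMonoSub f) (S : Finset N) {x : N → ℝ}
    (hx : ∀ u, x u = if u ∈ S then 1 else 0) (l : List N) :
    ∀ T ⊆ S, relaxed x l f T ≤ f S := by
  induction l with
  | nil => exact fun T hT => hf.mono _ _ hT
  | cons u l ih =>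
    intro T hT
    rw [relaxed_cons, mix, hx u]
    split_ifs with hu
    · simpa using ih _ (Finset.insert_subset hu hT)
    · simpa using ih _ hT

/-- The number of the sets `B j` that contain `u`. -/
def coverCount {L : ℕ} (B : Fin L → Finset N) (u : N) : ℝ :=
  ∑ j, if u ∈ B j then 1 else 0

lemma coverCount_nonneg {L : ℕ} (B : Fin L → Finset N) (u : N) : 0 ≤ coverCount B u :=
  Finset.sum_nonneg fun j _ => by split_ifs <;> norm_num

lemma coverCount_le {L : ℕ} (B : Fin L → Finset N) (u : N) : coverCount B u ≤ L := by
  calc coverCount B u ≤ ∑ _j : Fin L, (1 : ℝ) :=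
        Finset.sum_le_sum fun j _ => by split_ifs <;> norm_num
    _ = L := by simp

lemma coverCount_exchange {L : ℕ} (B : Fin L → Finset N) (i : Fin L) {b c : N}
    (hb : b ∈ B i) (hc : c ∉ B i) (u : N) :
    coverCount (Function.update B i (insert c ((B i).erase b))) u =
      coverCount B u + ((if u = c then 1 else 0) - (if u = b then 1 else 0)) := by
  unfold coverCount
  rw [Fintype.sum_eq_add_sum_compl i, Fintype.sum_eq_add_sum_compl i]
  have : ∑ j ∈ {i}ᶜ, (if u ∈ Function.update B i (insert c ((B i).erase b)) j then (1 : ℝ) else 0) =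
      ∑ j ∈ {i}ᶜ, (if u ∈ B j then (1 : ℝ) else 0) :=
    Finset.sum_congr rfl fun j hj => by
      rw [Function.update_of_ne (by simpa using hj)]
  rw [this, Function.update_self]
  have hbc : b ≠ c := fun h => hc (h ▸ hb)
  by_cases h1 : u = b
  · subst h1; simp [hbc, hb]
  · by_cases h2 : u = c
    · subst h2; simp [hc, h1, add_comm]
    · simp [h1, h2]

/-- Elements outside `D` become worthless: rounding may use them freely, and they are dropped
afterwards. -/
lemma IsMonoSub.comp_inter (hf : IsMonoSub f) (D : Finset N) : IsMonoSub fun S => f (S ∩ D) := by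
  refine ⟨fun S T h => hf.mono _ _ (Finset.inter_subset_inter_right h), fun S T h u => ?_⟩
  by_cases hu : u ∈ D
  · simpa only [Finset.insert_inter_of_mem hu] using
      hf.sub _ _ (Finset.inter_subset_inter_right h) u
  · simp [Finset.insert_inter_of_notMem hu]

lemma sampled_comp_inter (p : ℝ) {l : List N} {D : Finset N} (hl : ∀ u ∈ l, u ∈ D)
    (T : Finset N) : sampled p l (fun S => f (S ∩ D)) T = sampled p l f (T ∩ D) := by
  induction l generalizing T with
  | nil => rfl
  | cons u l ih =>
    have h := ih fun v hv => hl v (by simp [hv])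
    simp only [sampled_cons, mix, h, Finset.insert_inter_of_mem (hl u (by simp))]

variable [Fintype N]

/-- Independent sampling from a list with repetitions is dominated by the multilinear extension. -/
lemma IsMonoSub.sampled_le_relaxed (hf : IsMonoSub f) {p : ℝ} (h0 : 0 ≤ p) (l : List N)
    (h1 : ∀ u, l.count u * p ≤ 1) (T : Finset N) :
    sampled p l f T ≤ relaxed (fun u => l.count u * p) Finset.univ.toList f T := by
  induction l generalizing T with
  | nil => simp [relaxed_zero]
  | cons b l ih =>
    have hle : ∀ u, (l.count u : ℝ) * p ≤ ((b :: l).count u : ℝ) * p := fun u =>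
      mul_le_mul_of_nonneg_right (by exact_mod_cast List.count_le_count_cons) h0
    have hx1 : ∀ u, (l.count u : ℝ) * p ≤ 1 := fun u => (hle u).trans (h1 u)
    have hx0 : ∀ u, 0 ≤ (l.count u : ℝ) * p := fun u => by positivity
    have hb : ((b :: l).count b : ℝ) * p = l.count b * p + p := by
      rw [List.count_cons_self]; push_cast; ring
    have hp1 : p ≤ 1 := by have := h1 b; have := hx0 b; linarith
    have hperm := List.perm_cons_erase (Finset.mem_toList.2 (Finset.mem_univ b))
    have hnd : b ∉ (Finset.univ : Finset N).toList.erase b := by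
      simp [(Finset.nodup_toList _).mem_erase_iff]
    rw [sampled_cons]
    refine (mix_mono_fun h0 hp1 b (ih hx1) T).trans ?_
    rw [relaxed_perm _ hperm, relaxed_perm (fun u => ((b :: l).count u : ℝ) * p) hperm,
      relaxed_cons, relaxed_cons, hb,
      relaxed_congr (x := fun u => ((b :: l).count u : ℝ) * p) (y := fun u => (l.count u : ℝ) * p)]
    · have hH := hf.after_relaxed hx0 hx1 ((Finset.univ : Finset N).toList.erase b)
      set H := relaxed (fun u => (l.count u : ℝ) * p) ((Finset.univ : Finset N).toList.erase b) f
      -- With `q = l.count b * p`, two independent trials for `b` succeed with probability `p + q -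
      -- p * q`, against `p + q` in the extension; the product term is the slack.
      have := mul_nonneg (mul_nonneg h0 (hx0 b))
        (sub_nonneg.2 (hH.mono _ _ (Finset.subset_insert b T)))
      simp only [mix, Finset.insert_idem]
      linarith
    · intro u hu
      have : u ≠ b := fun h => hnd (h ▸ hu)
      simp [List.count_cons_of_ne this.symm]

/-- The multilinear extension is convex in the direction of an exchange of two elements. -/
lemma IsMonoSub.two_mul_relaxed_le (hf : IsMonoSub f) {x y z : N → ℝ} (h0 : ∀ u, 0 ≤ x u)
    (h1 : ∀ u, x u ≤ 1) {b c : N} (hbc : b ≠ c) (δ : ℝ)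
    (hy : ∀ u, y u = x u + δ * ((if u = c then 1 else 0) - (if u = b then 1 else 0)))
    (hz : ∀ u, z u = x u - δ * ((if u = c then 1 else 0) - (if u = b then 1 else 0)))
    (T : Finset N) :
    2 * relaxed x Finset.univ.toList f T ≤
      relaxed y Finset.univ.toList f T + relaxed z Finset.univ.toList f T := by
  set l := ((Finset.univ : Finset N).toList.erase b).erase c with hl
  have hnd : (Finset.univ : Finset N).toList.Nodup := Finset.nodup_toList _
  have hperm : (Finset.univ : Finset N).toList.Perm (b :: c :: l) := by
    refine (List.perm_cons_erase (Finset.mem_toList.2 (Finset.mem_univ b))).trans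
      (List.Perm.cons b (List.perm_cons_erase ?_))
    exact hnd.mem_erase_iff.2 ⟨hbc.symm, Finset.mem_toList.2 (Finset.mem_univ c)⟩
  have hnd' := hperm.nodup_iff.1 hnd
  have hbl : ∀ u ∈ l, u ≠ b ∧ u ≠ c := by
    rintro u hu
    simp only [List.nodup_cons, List.mem_cons, not_or] at hnd'
    exact ⟨fun h => hnd'.1.2 (h ▸ hu), fun h => hnd'.2.1 (h ▸ hu)⟩
  have hyl : relaxed y l f = relaxed x l f := relaxed_congr fun u hu => by
    simp [hy, hbl u hu]
  have hzl : relaxed z l f = relaxed x l f := relaxed_congr fun u hu => by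
    simp [hz, hbl u hu]
  simp only [relaxed_perm _ hperm, relaxed_cons, hyl, hzl]
  have hH := hf.after_relaxed h0 h1 l
  set H := relaxed x l f
  -- The extension is bilinear in the coordinates `b` and `c`. For opposite shifts the linear terms
  -- cancel, leaving `-2 * δ ^ 2` times a second difference that submodularity makes nonpositive.
  have hs := hH.sub T (insert b T) (Finset.subset_insert _ _) c
  have h2 := mul_nonneg (sq_nonneg δ) (sub_nonneg.2 hs)
  have e1 : y b = x b - δ := by simp [hy, hbc, sub_eq_add_neg]
  have e2 : y c = x c + δ := by simp [hy, hbc.symm]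
  have e3 : z b = x b + δ := by simp [hz, hbc]
  have e4 : z c = x c - δ := by simp [hz, hbc.symm]
  simp only [mix, e1, e2, e3, e4, Finset.insert_comm c b] at *
  nlinarith [h2]

/-- Pipage rounding of an average of `L` bases. -/
lemma IsMonoSub.exists_isBase_relaxed_le (hf : IsMonoSub f) (M : Matroid N) {L : ℕ} (hL : 0 < L)
    (B₀ : Fin L → Finset N) (hB₀ : ∀ j, M.IsBase (B₀ j : Set N)) :
    ∃ S : Finset N, M.IsBase (S : Set N) ∧
      relaxed (fun u => coverCount B₀ u / L) Finset.univ.toList f ∅ ≤ f S := by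
  classical
  have hL' : (0 : ℝ) < L := by exact_mod_cast hL
  let Φ : (Fin L → Finset N) → ℝ := fun B =>
    relaxed (fun u => coverCount B u / L) Finset.univ.toList f ∅
  let Q : (Fin L → Finset N) → ℝ := fun B => ∑ u, coverCount B u ^ 2
  -- Instead of iterating exchanges, take a tuple of bases that maximizes `Φ` and, among the
  -- maximizers, the strictly convex `Q`. This forces all its bases to coincide.
  obtain ⟨B₁, hB₁, hmax₁⟩ := (Finset.univ.filter fun B : Fin L → Finset N =>
    ∀ j, M.IsBase (B j : Set N)).exists_max_image Φ ⟨B₀, by simpa using hB₀⟩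
  obtain ⟨B, hB, hmax₂⟩ := (Finset.univ.filter fun B : Fin L → Finset N =>
    (∀ j, M.IsBase (B j : Set N)) ∧ Φ B₁ ≤ Φ B).exists_max_image Q
      ⟨B₁, by simpa using hB₁⟩
  simp only [Finset.mem_filter, Finset.mem_univ, true_and] at hB₁ hmax₁ hB hmax₂
  obtain ⟨hB, hBΦ⟩ := hB
  have hx0 : ∀ u, 0 ≤ coverCount B u / L := fun u => div_nonneg (coverCount_nonneg B u) hL'.le
  have hx1 : ∀ u, coverCount B u / L ≤ 1 := fun u =>
    (div_le_one hL').2 (coverCount_le B u)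
  have hall : ∀ i j, B i = B j := by
    intro i j
    by_contra hij
    have hnot : ¬ B i ⊆ B j := fun h => hij (by
      exact_mod_cast (hB i).eq_of_subset_isBase (hB j) (by exact_mod_cast h))
    obtain ⟨b, hbi, hbj⟩ := Finset.not_subset.1 hnot
    obtain ⟨c, hcj, hci, h₁, h₂⟩ := (hB i).exists_symm_exchange (hB j)
      (Finset.mem_coe.2 hbi) (by simpa using hbj)
    have hcj : c ∈ B j := by simpa using hcj
    have hci : c ∉ B i := by simpa using hci
    have hbc : b ≠ c := fun h => hci (h ▸ hbi)
    let C := Function.update B i (insert c ((B i).erase b))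
    let D := Function.update B j (insert b ((B j).erase c))
    have hC : ∀ k, M.IsBase (C k : Set N) := by
      intro k
      by_cases hk : k = i
      · subst hk; simpa [C] using h₁
      · simpa [C, Function.update_of_ne hk] using hB k
    have hD : ∀ k, M.IsBase (D k : Set N) := by
      intro k
      by_cases hk : k = j
      · subst hk; simpa [D] using h₂
      · simpa [D, Function.update_of_ne hk] using hB k
    have hmC := coverCount_exchange B i hbi hci
    have hmD := coverCount_exchange B j hcj hbj
    -- The two exchanges move the average by `1 / L` in opposite directions. By convexity both
    -- results are again maximizers of `Φ`, yet `Q` grows on average.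
    have hconv : 2 * Φ B ≤ Φ C + Φ D := by
      refine hf.two_mul_relaxed_le hx0 hx1 hbc (1 / L) (fun u => ?_) (fun u => ?_) ∅
      · rw [hmC u]; ring
      · rw [hmD u]; ring
    have hQC := hmax₂ C ⟨hC, by have := hmax₁ D hD; have := hmax₁ C hC; linarith⟩
    have hQD := hmax₂ D ⟨hD, by have := hmax₁ D hD; have := hmax₁ C hC; linarith⟩
    have hQ : Q C + Q D = 2 * Q B +
        2 * ∑ u, ((if u = c then (1 : ℝ) else 0) - (if u = b then 1 else 0)) ^ 2 := by
      simp only [Q, Finset.mul_sum, ← Finset.sum_add_distrib]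
      refine Finset.sum_congr rfl fun u _ => ?_
      rw [hmC u, hmD u]; ring
    have hpos : 1 ≤ ∑ u, ((if u = c then (1 : ℝ) else 0) - (if u = b then 1 else 0)) ^ 2 := by
      refine le_trans ?_ (Finset.single_le_sum (fun u _ => sq_nonneg _) (Finset.mem_univ c))
      simp [hbc.symm]
    linarith
  refine ⟨B ⟨0, hL⟩, hB _, (hmax₁ B₀ hB₀).trans (hBΦ.trans ?_)⟩
  refine hf.relaxed_indicator_le _ (fun u => ?_) _ ∅ (Finset.empty_subset _)
  have : coverCount B u = L * if u ∈ B ⟨0, hL⟩ then 1 else 0 := by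
    unfold coverCount
    rw [Finset.sum_congr rfl fun j _ => by rw [hall j ⟨0, hL⟩]]
    simp
  rw [this]
  field_simp

/-- The union of random subsets of `L` independent sets, sampled at rate `1 / L`, is worth no more
than some independent set among their elements. -/
lemma IsMonoSub.exists_indep_sampled_le (hf : IsMonoSub f) (M : Matroid N) (slots : List (List N))
    (hne : slots ≠ []) (hslots : ∀ s ∈ slots, s.Nodup ∧ M.Indep (s.toFinset : Set N)) :
    ∃ S : Finset N, M.Indep (S : Set N) ∧ S ⊆ slots.flatten.toFinset ∧
      sampled (1 / slots.length) slots.flatten f ∅ ≤ f S := by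
  classical
  have hL : 0 < slots.length := List.length_pos_iff.2 hne
  have hL' : (0 : ℝ) < slots.length := by exact_mod_cast hL
  set D := slots.flatten.toFinset
  -- Completing the sets to bases only raises coordinates, which still stay at most `1` in the
  -- average.
  have hex : ∀ j : Fin slots.length, ∃ B : Finset N, M.IsBase (B : Set N) ∧
      slots[j].toFinset ⊆ B := by
    intro j
    obtain ⟨B, hB, hsub⟩ := (hslots slots[j] (List.getElem_mem _)).2.exists_isBase_superset
    exact ⟨B.toFinset, by simpa using hB, by
      intro u hu; simpa using hsub (by simpa using hu)⟩
  choose B hB hsB using hex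
  have hcount : ∀ u, (slots.flatten.count u : ℝ) ≤ coverCount B u := by
    intro u
    rw [List.count_flatten, ← Fin.sum_univ_fun_getElem, Nat.cast_sum]
    refine Finset.sum_le_sum fun j _ => ?_
    by_cases hu : u ∈ slots[j]
    · rw [if_pos (hsB j (List.mem_toFinset.2 hu))]
      exact_mod_cast List.nodup_iff_count_le_one.1 (hslots _ (List.getElem_mem j.2)).1 u
    · have h0 : List.count u slots[j.1] = 0 := List.count_eq_zero_of_not_mem hu
      rw [h0, Nat.cast_zero]
      split_ifs <;> norm_num
  have hfD := hf.comp_inter D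
  obtain ⟨S, hS, hle⟩ := hfD.exists_isBase_relaxed_le M hL B hB
  refine ⟨S ∩ D, hS.indep.subset (by simp), Finset.inter_subset_right, ?_⟩
  have h1 : ∀ u, (slots.flatten.count u : ℝ) * (1 / slots.length) ≤
      coverCount B u / slots.length := fun u => by
    rw [mul_one_div]; exact div_le_div_of_nonneg_right (hcount u) hL'.le
  have h2 : ∀ u, coverCount B u / slots.length ≤ 1 := fun u =>
    (div_le_one hL').2 (coverCount_le B u)
  have h3 := sampled_comp_inter (f := f) (1 / slots.length) (l := slots.flatten) (D := D)
    (fun u hu => List.mem_toFinset.2 hu) ∅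
  rw [Finset.empty_inter] at h3
  rw [← h3]
  exact ((hfD.sampled_le_relaxed (by positivity) _ fun u => (h1 u).trans (h2 u)) ∅).trans
    ((hfD.relaxed_le_relaxed (fun u => by positivity) h1 h2 _ ∅).trans hle)

end Rounding

/-! ### One pass of exchanges -/

/-- The weight of `b` in the list `l`, whose most recent element comes first: the expected marginal
value of `b` with respect to the elements that were already there when `b` was inserted. -/
def weight {ι : Type*} [DecidableEq ι] (p : ℝ) (F : Finset ι → ℝ) : List ι → ι → ℝ
  | [], _ => 0
  | c :: l, b => if b = c then marg p F l c else weight p F l b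

/-- What is done with the solution `B` when `u` is read: `u` is ignored if it belongs to `B`, and
added if that keeps `B` independent; otherwise it replaces the lightest element that it can
replace, provided that it is heavier by a factor of `1 + α`. -/
inductive ExchangeStep {N : Type*} [DecidableEq N] (M : Matroid N) (p α : ℝ) (F : Finset N → ℝ)
    (B : List N) (u : N) : List N → Prop
  | present (hu : u ∈ B) : ExchangeStep M p α F B u B
  | add (hu : u ∉ B) (hi : M.Indep (insert u (B.toFinset : Set N))) :
      ExchangeStep M p α F B u (u :: B)
  | swap (l l' : List N) (b : N) (hB : B = l ++ b :: l') (hu : u ∉ B)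
      (hd : ¬ M.Indep (insert u (B.toFinset : Set N)))
      (hi : M.Indep (insert u ((B.toFinset : Set N) \ {b})))
      (hmin : ∀ c ∈ B, M.Indep (insert u ((B.toFinset : Set N) \ {c})) →
        weight p F B b ≤ weight p F B c)
      (hw : (1 + α) * weight p F B b ≤ marg p F B u) : ExchangeStep M p α F B u (u :: (l ++ l'))
  | reject (hu : u ∉ B) (hd : ¬ M.Indep (insert u (B.toFinset : Set N)))
      (hw : ∀ c ∈ B, M.Indep (insert u ((B.toFinset : Set N) \ {c})) →
        marg p F B u ≤ (1 + α) * weight p F B c) : ExchangeStep M p α F B u B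

/-- What is known after the elements of `seen` have been read, in a pass that began with the
solution `B₀` and has reached the solution `B`; here `A` is the list of all elements that belonged
to the solution during the pass. -/
structure PassState {N : Type*} [DecidableEq N] (M : Matroid N) (p α : ℝ) (F : Finset N → ℝ)
    (B₀ : List N) (seen : Set N) (B A : List N) : Prop where
  nodup : B.Nodup
  indep : M.Indep (B.toFinset : Set N)
  sublist : B.Sublist A
  le : sampled p B₀ F ∅ ≤ sampled p B F ∅
  value_le : sampled p A F ∅ ≤
    sampled p B₀ F ∅ + (1 + α) / α * (sampled p B F ∅ - sampled p B₀ F ∅)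
  mem_closure : ∀ o ∈ seen,
    o ∈ M.closure {b | b ∈ B.toFinset ∧ marg p F A o / (1 + α) ≤ weight p F B b}

/-- The other elements of a circuit formed by adding `u` to an independent set can be exchanged
for `u`, and they span `u`. -/
lemma Matroid.Indep.exists_circuit_of_not_indep_insert {N : Type*} {M : Matroid N}
    {I : Set N} (hI : M.Indep I) {u : N}
    (huE : u ∈ M.E) (hu : u ∉ I) (hd : ¬ M.Indep (insert u I)) :
    ∃ C ⊆ insert u I, u ∈ C ∧ (∀ c ∈ C, c ∈ M.closure (C \ {c})) ∧
      ∀ c ∈ I, (c ∈ C ↔ M.Indep (insert u (I \ {c}))) := by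
  have hcl : u ∈ M.closure I := by
    by_contra h
    exact hd (hI.insert_indep_iff.2 (Or.inl ⟨huE, h⟩))
  refine ⟨M.fundCircuit u I, M.fundCircuit_subset_insert u I, M.mem_fundCircuit u I,
    fun c hc => (hI.fundCircuit_isCircuit hcl hu).mem_closure_sdiff_singleton_of_mem hc,
    fun c hc => ?_⟩
  have hcu : u ∉ ({c} : Set N) := fun h => hu (by rw [Set.mem_singleton_iff.1 h]; exact hc)
  rw [hI.mem_fundCircuit_iff hcl hu, Set.insert_sdiff_of_notMem _ hcu]

section Pass

variable {N : Type*} [DecidableEq N] {M : Matroid N} {p α : ℝ} {F : Finset N → ℝ}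

lemma weight_nonneg (hF : IsMonoSub F) (h0 : 0 ≤ p) (h1 : p ≤ 1) (l : List N) (b : N) :
    0 ≤ weight p F l b := by
  induction l with
  | nil => exact le_rfl
  | cons c l ih =>
    rw [weight]; split_ifs
    · exact hF.marg_nonneg h0 h1 _ _
    · exact ih

lemma marg_le_weight (hF : IsMonoSub F) (h0 : 0 ≤ p) (h1 : p ≤ 1) {l : List N} {b : N}
    (hb : b ∈ l) : marg p F l b ≤ weight p F l b := by
  induction l with
  | nil => simp at hb
  | cons c l ih =>
    rw [weight]; split_ifs with h
    · subst h; exact hF.marg_le_of_sublist h0 h1 (List.sublist_cons_self _ _) _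
    · exact (hF.marg_le_of_sublist h0 h1 (List.sublist_cons_self _ _) _).trans
        (ih ((List.mem_cons.1 hb).resolve_left h))

lemma weight_append_cons_self (l l' : List N) {b : N} (hb : b ∉ l) :
    weight p F (l ++ b :: l') b = marg p F l' b := by
  induction l with
  | nil => simp [weight]
  | cons c l ih =>
    simp only [List.mem_cons, not_or] at hb
    simp [weight, hb.1, ih hb.2]

/-- When `b` leaves, the elements inserted after it lose a predecessor, so weight thresholds survive
a swap. -/
lemma weight_append_cons_le (hF : IsMonoSub F) (h0 : 0 ≤ p) (h1 : p ≤ 1) (l l' : List N)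
    {b c : N} (hc : c ≠ b) : weight p F (l ++ b :: l') c ≤ weight p F (l ++ l') c := by
  induction l with
  | nil => simp [weight, hc]
  | cons d l ih =>
    simp only [List.cons_append, weight]
    split_ifs
    · refine hF.marg_le_of_sublist h0 h1 ?_ _
      exact List.Sublist.append (List.Sublist.refl _) (List.sublist_cons_self _ _)
    · exact ih

/-- The sum telescopes along the order of insertion. -/
lemma sum_weight {l : List N} (hl : l.Nodup) :
    p * ∑ b ∈ l.toFinset, weight p F l b = sampled p l F ∅ - F ∅ := by
  induction l with
  | nil => simp
  | cons c l ih =>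
    rw [List.nodup_cons] at hl
    have hc : c ∉ l.toFinset := by simpa using hl.1
    rw [List.toFinset_cons, Finset.sum_insert hc, sampled_cons_empty, mul_add]
    have : ∑ b ∈ l.toFinset, weight p F (c :: l) b = ∑ b ∈ l.toFinset, weight p F l b :=
      Finset.sum_congr rfl fun b hb => by
        rw [weight, if_neg (fun h : b = c => hc (h ▸ hb))]
    rw [this, ih hl.2, weight, if_pos rfl]; ring

lemma PassState.start {B₀ : List N} (hnd : B₀.Nodup) (hi : M.Indep (B₀.toFinset : Set N)) :
    PassState M p α F B₀ ∅ B₀ B₀ where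
  nodup := hnd
  indep := hi
  sublist := List.Sublist.refl _
  le := le_rfl
  value_le := by simp
  mem_closure := by simp

/-- An insertion adds at most `p * marg p F B u` to the value of `A`, because `B` is a sublist of
`A`, and at least the fraction `α / (1 + α)` of this to the value of `B`. An element that is refused
or removed remains spanned by the rest of the circuit that `u` closes in `B`. -/
lemma PassState.step (hF : IsMonoSub F) (hp0 : 0 < p) (hp1 : p ≤ 1) (hα : 0 < α)
    (hE : M.E = Set.univ) {B₀ B A B' : List N} {seen : Set N} {u : N}
    (h : PassState M p α F B₀ seen B A) (hs : ExchangeStep M p α F B u B') :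
    ∃ A', PassState M p α F B₀ (insert u seen) B' A' := by
  have hα1 : 0 < 1 + α := by linarith
  have hdiv : ∀ (l : List N) (o : N), marg p F l o / (1 + α) ≤ marg p F l o := fun l o =>
    div_le_self (hF.marg_nonneg hp0.le hp1 l o) (by linarith)
  have hE' : ∀ S : Set N, S ⊆ M.E := fun S => hE ▸ Set.subset_univ S
  have hratio : 1 ≤ (1 + α) / α := (one_le_div hα).2 (by linarith)
  have hBA := hF.marg_le_of_sublist hp0.le hp1 h.sublist u
  have hmono : ∀ v, marg p F (u :: A) v ≤ marg p F A v := fun v =>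
    hF.marg_le_of_sublist hp0.le hp1 (List.sublist_cons_self _ _) v
  have hdivmono : ∀ v, marg p F (u :: A) v / (1 + α) ≤ marg p F A v / (1 + α) := fun v =>
    div_le_div_of_nonneg_right (hmono v) hα1.le
  have hmu := hF.marg_nonneg hp0.le hp1 B u
  have hpmu : 0 ≤ p * marg p F B u := mul_nonneg hp0.le hmu
  have hpBA := mul_le_mul_of_nonneg_left hBA hp0.le
  cases hs with
  | present hu =>
    refine ⟨A, h.nodup, h.indep, h.sublist, h.le, h.value_le, ?_⟩
    rintro o (rfl | ho)
    · refine M.mem_closure_of_mem ?_ (hE' _)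
      exact ⟨List.mem_toFinset.2 hu,
        (hdiv A o).trans (hBA.trans (marg_le_weight hF hp0.le hp1 hu))⟩
    · exact h.mem_closure o ho
  | add hu hi =>
    refine ⟨u :: A, List.nodup_cons.2 ⟨hu, h.nodup⟩, by simpa using hi, h.sublist.cons_cons u,
      ?_, ?_, ?_⟩
    · rw [sampled_cons_empty]; have := h.le; linarith
    · rw [sampled_cons_empty, sampled_cons_empty]
      have := h.value_le
      have := mul_le_mul_of_nonneg_right hratio hpmu
      linarith
    · rintro o (rfl | ho)
      · refine M.mem_closure_of_mem ?_ (hE' _)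
        refine ⟨by simp, ?_⟩
        rw [weight, if_pos rfl]
        exact (hdivmono o).trans ((hdiv A o).trans hBA)
      · refine M.closure_subset_closure ?_ (h.mem_closure o ho)
        rintro b ⟨hb, hbw⟩
        refine ⟨by rw [List.toFinset_cons]; exact Finset.mem_insert_of_mem hb, ?_⟩
        rw [weight, if_neg fun hbu : b = u => hu (hbu ▸ List.mem_toFinset.1 hb)]
        exact (hdivmono o).trans hbw
  | swap l l' b hB hu hd hi hmin hw =>
    have hnd := h.nodup
    rw [hB] at hnd
    have hbl : b ∉ l := fun hb =>
      (List.disjoint_of_nodup_append hnd) hb List.mem_cons_self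
    have hwb : weight p F B b = marg p F l' b := by rw [hB, weight_append_cons_self l l' hbl]
    have hsub : (l ++ l').Sublist B := by
      rw [hB]; exact List.Sublist.append (List.Sublist.refl _) (List.sublist_cons_self _ _)
    have hbll : b ∉ l ++ l' := by
      have h2 := List.nodup_middle.1 hnd
      exact (List.nodup_cons.1 h2).1
    have hmem : ∀ c, c ∈ l ++ l' ↔ c ∈ B ∧ c ≠ b := by
      intro c
      constructor
      · exact fun hc => ⟨hsub.subset hc, fun hcb => hbll (hcb ▸ hc)⟩
      · rintro ⟨hc, hcb⟩
        rw [hB] at hc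
        simp only [List.mem_append, List.mem_cons] at hc ⊢
        tauto
    have hset : (((u :: (l ++ l')).toFinset : Finset N) : Set N) =
        insert u ((B.toFinset : Set N) \ {b}) := by
      ext c
      have := hmem c
      simp only [List.toFinset_cons, Finset.coe_insert, Set.mem_insert_iff, Finset.mem_coe,
        List.mem_toFinset, Set.mem_sdiff, Set.mem_singleton_iff]
      tauto
    -- Removing `b` costs at most `p` times its weight, hence at most `p * marg p F B u / (1 + α)`.
    have hgain : sampled p B F ∅ + α / (1 + α) * (p * marg p F B u) ≤
        sampled p (u :: (l ++ l')) F ∅ := by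
      have h1 := hF.sampled_append_cons_le hp0.le hp1 l l' b
      rw [← hB, ← hwb] at h1
      rw [sampled_cons_empty]
      have h2 := mul_le_mul_of_nonneg_left (hF.marg_le_of_sublist hp0.le hp1 hsub u) hp0.le
      have h3 : weight p F B b ≤ marg p F B u / (1 + α) := by
        rw [le_div_iff₀ hα1]; linarith
      have h4 := mul_le_mul_of_nonneg_left h3 hp0.le
      have h5 : α / (1 + α) * (p * marg p F B u) =
          p * marg p F B u - p * (marg p F B u / (1 + α)) := by field_simp; ring
      linarith
    have hub : weight p F B b ≤ marg p F B u := by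
      have := mul_nonneg hα.le (weight_nonneg hF hp0.le hp1 B b)
      linarith
    have hwu : marg p F B u ≤ weight p F (u :: (l ++ l')) u := by
      rw [weight, if_pos rfl]
      exact hF.marg_le_of_sublist hp0.le hp1 hsub u
    have hlev : ∀ t, ∀ c ∈ B, c ≠ b → t ≤ weight p F B c →
        c ∈ {c | c ∈ (u :: (l ++ l')).toFinset ∧ t ≤ weight p F (u :: (l ++ l')) c} := by
      intro t c hc hcb hct
      refine ⟨by
        rw [List.mem_toFinset]; exact List.mem_cons_of_mem _ ((hmem c).2 ⟨hc, hcb⟩), ?_⟩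
      rw [weight, if_neg fun hcu : c = u => hu (hcu ▸ hc)]
      exact (hB ▸ hct).trans (weight_append_cons_le hF hp0.le hp1 l l' hcb)
    refine ⟨u :: A, List.nodup_cons.2 ⟨fun hc => hu (hsub.subset hc), hsub.nodup h.nodup⟩,
      hset ▸ hi, (hsub.trans h.sublist).cons_cons u, ?_, ?_, ?_⟩
    · have := h.le
      have : 0 ≤ α / (1 + α) * (p * marg p F B u) := by positivity
      linarith
    · rw [sampled_cons_empty u A]
      have h1 := h.value_le
      have h2 := mul_le_mul_of_nonneg_left hgain (by linarith : 0 ≤ (1 + α) / α)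
      have h3 : (1 + α) / α * (α / (1 + α) * (p * marg p F B u)) = p * marg p F B u := by
        field_simp
      linarith
    · rintro o (rfl | ho)
      · refine M.mem_closure_of_mem ⟨by simp, ?_⟩ (hE' _)
        exact (hdivmono o).trans ((hdiv A o).trans (hBA.trans hwu))
      · refine M.closure_subset_closure_of_subset_closure ?_ (h.mem_closure o ho)
        rintro c ⟨hc, hcw⟩
        have hcw := (hdivmono o).trans hcw
        rw [List.mem_toFinset] at hc
        by_cases hcb : c = b
        -- The rest of the circuit consists of `u` and of elements that `u` could have replaced as
        -- well; by the choice of the lightest, none weighs less than the departing element did.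
        · subst hcb
          obtain ⟨C, hCsub, huC, hCcl, hCex⟩ := h.indep.exists_circuit_of_not_indep_insert
            (hE ▸ Set.mem_univ u) (by simpa using hu) hd
          have hcC : c ∈ C := (hCex c (by simpa using hc)).2 hi
          refine M.closure_subset_closure ?_ (hCcl c hcC)
          rintro d ⟨hdC, hdc⟩
          rcases hCsub hdC with rfl | hdB
          · exact ⟨by simp, hcw.trans (hub.trans hwu)⟩
          · have hdB' : d ∈ B := by simpa using hdB
            exact hlev _ d hdB' hdc (hcw.trans (hmin d hdB' ((hCex d hdB).1 hdC)))
        · exact M.mem_closure_of_mem (hlev _ c hc hcb hcw) (hE' _)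
  | reject hu hd hw =>
    refine ⟨A, h.nodup, h.indep, h.sublist, h.le, h.value_le, ?_⟩
    rintro o (rfl | ho)
    -- Only a rejection uses up the factor `1 + α` in the threshold.
    · obtain ⟨C, hCsub, huC, hCcl, hCex⟩ := h.indep.exists_circuit_of_not_indep_insert
        (hE ▸ Set.mem_univ o) (by simpa using hu) hd
      refine M.closure_subset_closure ?_ (hCcl o huC)
      rintro d ⟨hdC, hdo⟩
      have hdB := (hCsub hdC).resolve_left hdo
      refine ⟨by simpa using hdB, ?_⟩
      rw [div_le_iff₀ hα1]
      have := hw d (by simpa using hdB) ((hCex d hdB).1 hdC)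
      linarith
    · exact h.mem_closure o ho

/-- After a complete pass, the value of any independent set is bounded in terms of the value of the
solution. -/
lemma PassState.le_of_indep (hF : IsMonoSub F) (hp0 : 0 < p) (hp1 : p ≤ 1) (hα : 0 < α)
    {B₀ B A : List N} (h : PassState M p α F B₀ Set.univ B A) {O : Finset N}
    (hO : M.Indep (O : Set N)) :
    F O ≤ sampled p B₀ F ∅ + (1 + α) / α * (sampled p B F ∅ - sampled p B₀ F ∅) +
      (1 + α) / p * (sampled p B F ∅ - F ∅) := by
  have hα1 : 0 < 1 + α := by linarith
  have h1 := hF.le_add_sum_marg hp0.le hp1 A O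
  have h2 := hO.sum_le_sum_of_mem_closure (B := B.toFinset) (fun o => marg p F A o / (1 + α))
    (weight p F B) (weight_nonneg hF hp0.le hp1 B) fun o _ => h.mem_closure o (Set.mem_univ o)
  rw [← Finset.sum_div, div_le_iff₀ hα1] at h2
  have h3 : (1 + α) / p * (sampled p B F ∅ - F ∅) =
      (∑ b ∈ B.toFinset, weight p F B b) * (1 + α) := by
    rw [← sum_weight h.nodup]; field_simp
  have := h.value_le
  linarith

end Pass

/-! ### The algorithm -/

section Exchange

variable {ι : Type*} [DecidableEq ι]

/-- The weight of the element at position `i` of `D`. -/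
def weightAt (p : ℝ) (v : Finset ι → ℝ) (D : List ι) (i : ℕ) : ℝ :=
  match D[i]? with
  | some d => marg p v (D.drop (i + 1)) d
  | none => 0

/-- `u` can replace the element at position `i < n` of the solution `D.take n`. -/
def CanSwap (ind : Finset ι → Prop) (D : List ι) (n : ℕ) (u : ι) (i : ℕ) : Prop :=
  i < n ∧ ind (u :: (D.take n).eraseIdx i).toFinset

/-- Position `i` holds the lightest element that `u` can replace, and `u` is heavy enough. -/
def IsBestSwap (p : ℝ) (v : Finset ι → ℝ) (ind : Finset ι → Prop) (D : List ι) (n : ℕ) (u : ι)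
    (i : ℕ) : Prop :=
  CanSwap ind D n u i ∧ (∀ j, CanSwap ind D n u j → weightAt p v D i ≤ weightAt p v D j) ∧
    (1 + p) * weightAt p v D i ≤ marg p v D u

open Classical in
/-- The new size of the solution and the new list of stored elements after `u` is read, when the
solution consists of the first `n` members of the list `D` of stored elements. -/
noncomputable def exchange (p : ℝ) (v : Finset ι → ℝ) (ind : Finset ι → Prop) (present : Prop)
    (D : List ι) (n : ℕ) (u : ι) : ℕ × List ι :=
  if present then (n, D)
  else if ind (u :: D.take n).toFinset then (n + 1, u :: D)
  else if h : ∃ i, IsBestSwap p v ind D n u i then (n, u :: D.eraseIdx h.choose)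
  else (n, D)

variable {N : Type*} [DecidableEq N]

lemma weightAt_map (p : ℝ) (f : Finset N → ℝ) (e : ι → N) (D : List ι) (i : ℕ) :
    weightAt p (fun J => f (J.image e)) D i = weightAt p f (D.map e) i := by
  unfold weightAt
  rw [List.getElem?_map]
  cases D[i]? with
  | none => rfl
  | some d => simp [marg_comp_image]

lemma canSwap_map (ind : Finset N → Prop) (e : ι → N) (D : List ι) (n : ℕ) (u : ι) (i : ℕ) :
    CanSwap (fun J => ind (J.image e)) D n u i ↔ CanSwap ind (D.map e) n (e u) i := by
  unfold CanSwap
  have : (u :: (D.take n).eraseIdx i).toFinset.image e =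
      (e u :: ((D.map e).take n).eraseIdx i).toFinset := by
    ext x; simp [← List.map_take, List.eraseIdx_map, eq_comm]
  simp only [this]

lemma isBestSwap_map (p : ℝ) (f : Finset N → ℝ) (ind : Finset N → Prop) (e : ι → N) (D : List ι)
    (n : ℕ) (u : ι) (i : ℕ) :
    IsBestSwap p (fun J => f (J.image e)) (fun J => ind (J.image e)) D n u i ↔
      IsBestSwap p f ind (D.map e) n (e u) i := by
  simp only [IsBestSwap, weightAt_map, canSwap_map, marg_comp_image]

/-- The older solutions stand behind `B`, so everything behind position `i` is what preceded `B[i]`,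
in this phase or before. -/
lemma weightAt_append {p : ℝ} {f : Finset N → ℝ} {B old : List N} (hB : B.Nodup) {i : ℕ}
    (hi : i < B.length) :
    weightAt p f (B ++ old) i = weight p (sampled p old f) B B[i] := by
  have h1 : (B ++ old)[i]? = some B[i] := by
    rw [List.getElem?_append_left hi, List.getElem?_eq_getElem hi]
  have h2 : (B ++ old).drop (i + 1) = B.drop (i + 1) ++ old := List.drop_append_of_le_length hi
  have h3 : B = B.take i ++ B[i] :: B.drop (i + 1) := by
    rw [← List.drop_eq_getElem_cons, List.take_append_drop]
  have h4 : B[i] ∉ B.take i := by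
    intro hmem
    have hB' := hB
    rw [h3] at hB'
    exact List.disjoint_of_nodup_append hB' hmem List.mem_cons_self
  have h5 := weight_append_cons_self (p := p) (F := sampled p old f) (B.take i) (B.drop (i + 1)) h4
  rw [← h3] at h5
  rw [h5, weightAt, h1]
  simp only [h2, marg_append]

lemma toFinset_eraseIdx {B : List N} (hB : B.Nodup) {i : ℕ} (hi : i < B.length) :
    (((B.eraseIdx i).toFinset : Finset N) : Set N) = (B.toFinset : Set N) \ {B[i]} := by
  ext x
  rw [← List.Nodup.erase_getElem hB i hi]
  simp [hB.mem_erase_iff, and_comm]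

lemma canSwap_append {M : Matroid N} {B old : List N} (hB : B.Nodup) {u : N} {i : ℕ}
    (hi : i < B.length) :
    CanSwap (fun J => M.Indep (J : Set N)) (B ++ old) B.length u i ↔
      M.Indep (insert u ((B.toFinset : Set N) \ {B[i]})) := by
  simp only [CanSwap, hi, true_and, List.take_left, List.toFinset_cons, Finset.coe_insert,
    toFinset_eraseIdx hB hi]

/-- The oracles are pulled back along `e`, so decisions about positions are exchange steps on
elements. -/
lemma exchange_spec {M : Matroid N} {p : ℝ} (hp : 0 ≤ p) {f : Finset N → ℝ} (e : ι → N) {D : List ι}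
    {B old : List N} (hD : D.map e = B ++ old) (hB : B.Nodup) (u : ι) {present : Prop}
    (hpres : present ↔ e u ∈ B) :
    ∃ B', ExchangeStep M p p (sampled p old f) B (e u) B' ∧
      let r := exchange p (fun J => f (J.image e)) (fun J => M.Indep (J.image e : Set N)) present
        D B.length u
      r.1 = B'.length ∧ r.2.map e = B' ++ old := by
  unfold exchange
  have himage : ∀ l : List ι, (u :: l).toFinset.image e = (e u :: l.map e).toFinset := by
    intro l; ext x; simp [eq_comm]
  have htake := himage (D.take B.length)
  rw [List.map_take, hD, List.take_left] at htake
  by_cases h1 : present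
  · exact ⟨B, .present (hpres.1 h1), by simp [h1, hD]⟩
  have hu : e u ∉ B := fun h => h1 (hpres.2 h)
  have hiff : M.Indep ((u :: D.take B.length).toFinset.image e : Set N) ↔
      M.Indep (insert (e u) (B.toFinset : Set N)) := by
    rw [htake, List.toFinset_cons, Finset.coe_insert]
  rw [if_neg h1]
  by_cases h2 : M.Indep ((u :: D.take B.length).toFinset.image e : Set N)
  · rw [if_pos h2]
    exact ⟨e u :: B, .add hu (hiff.1 h2), by simp [hD]⟩
  have hd : ¬ M.Indep (insert (e u) (B.toFinset : Set N)) := fun h => h2 (hiff.2 h)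
  rw [if_neg h2]
  have hbest := isBestSwap_map p f (fun J => M.Indep (J : Set N)) e D B.length u
  have hidx : ∀ c ∈ B, ∃ j, ∃ hj : j < B.length, B[j] = c := fun c hc => List.getElem_of_mem hc
  by_cases h3 : ∃ i, IsBestSwap p (fun J => f (J.image e))
      (fun J => M.Indep (J.image e : Set N)) D B.length u i
  · rw [dif_pos h3]
    have hi := (hbest _).1 h3.choose_spec
    set i := h3.choose
    rw [hD] at hi
    obtain ⟨hcan, hmin, hw⟩ := hi
    have hiB : i < B.length := hcan.1
    rw [weightAt_append hB hiB, marg_append] at hw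
    have hsplit : B = B.take i ++ B[i] :: B.drop (i + 1) := by
      rw [← List.drop_eq_getElem_cons, List.take_append_drop]
    refine ⟨_, .swap _ _ B[i] hsplit hu hd ((canSwap_append hB hiB).1 hcan) ?_ hw, ?_, ?_⟩
    · intro c hc hci
      obtain ⟨j, hj, rfl⟩ := hidx c hc
      have := hmin j ((canSwap_append hB hj).2 hci)
      rwa [weightAt_append hB hiB, weightAt_append hB hj] at this
    · simp; omega
    · rw [List.map_cons, ← List.eraseIdx_map, hD, List.eraseIdx_append_of_lt_length hiB,
        List.eraseIdx_eq_take_drop_succ]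
      simp
  · rw [dif_neg h3]
    refine ⟨B, .reject hu hd ?_, rfl, hD⟩
    -- If `u` were heavy enough for some replaceable element, it would be so for the lightest one,
    -- and a best swap would exist.
    intro c hc hci
    by_contra hlt
    push Not at hlt
    apply h3
    classical
    let cand := (Finset.range B.length).filter
      (CanSwap (fun J => M.Indep (J : Set N)) (B ++ old) B.length (e u))
    obtain ⟨j, hj, rfl⟩ := hidx c hc
    have hjc := (canSwap_append (old := old) hB hj).2 hci
    have hcand : ∀ k, k ∈ cand ↔
        CanSwap (fun J => M.Indep (J : Set N)) (B ++ old) B.length (e u) k := fun k => by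
      simp only [cand, Finset.mem_filter, Finset.mem_range, and_iff_right_iff_imp]
      exact fun h => h.1
    obtain ⟨i, hi, hmin⟩ := cand.exists_min_image (weightAt p f (B ++ old)) ⟨j, (hcand j).2 hjc⟩
    refine ⟨i, (hbest i).2 ?_⟩
    rw [hD]
    refine ⟨(hcand i).1 hi, fun k hk => hmin k ((hcand k).2 hk), ?_⟩
    have hij := hmin j ((hcand j).2 hjc)
    rw [weightAt_append hB hj] at hij
    rw [marg_append]
    exact (mul_le_mul_of_nonneg_left hij (by linarith)).trans hlt.le

end Exchange

open Classical in
/-- The algorithm works in phases of `T` passes each. The list of stored elements consists of the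
solution of the current phase, whose size is the number of `true` bits, and of the solutions of the
previous phases. The number of `false` bits is the number of completed passes. -/
noncomputable def exchangeAlgorithm (p : ℝ) (T passes : ℕ) : StreamAlgorithm where
  passes := passes
  init := []
  onElement bits m V :=
    let D := (List.finRange m).map Fin.succ
    let r := exchange p V.value V.indep (∃ j ∈ D.take (bits.count true), V.same 0 j) D
      (bits.count true) 0
    (List.replicate r.1 true ++ List.replicate (bits.count false) false, r.2)
  onPassEnd bits m _ :=
    -- The pass just completed has number `bits.count false + 1`. Resetting the size to `0` turns
    -- the current solution into the newest old one without moving any element.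
    (List.replicate (if T ∣ bits.count false + 1 then 0 else bits.count true) true ++
      List.replicate (bits.count false + 1) false, List.finRange m)
  output _ _ V :=
    -- A best independent set always exists, since the empty set is independent; the default is
    -- never used.
    if h : ∃ I, V.indep I ∧ ∀ J, V.indep J → V.value J ≤ V.value I then h.choose else ∅

lemma count_true_replicate_append (m n : ℕ) :
    (List.replicate m true ++ List.replicate n false).count true = m := by
  simp [List.count_append, List.count_replicate]

lemma count_false_replicate_append (m n : ℕ) :
    (List.replicate m true ++ List.replicate n false).count false = n := by
  simp [List.count_append, List.count_replicate]

lemma StreamAlgorithm.count_none_reads_le {N : Type*} [DecidableEq N] (A : StreamAlgorithm)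
    (σ : List N) (t : ℕ) :
    ((A.reads σ).take t).count none ≤ A.passes := by
  refine ((List.take_sublist t _).count_le none).trans ?_
  have h0 : (σ.map some).count none = 0 := List.count_eq_zero_of_not_mem (by simp)
  simp [StreamAlgorithm.reads, List.count_flatten, h0]

/-! ### Invariants of the memory during a run -/

section Run

variable {N : Type*} [Fintype N] [DecidableEq N] {P : MSMMatroid N}

/-- The memory holds the current solution `B` and the list `slots` of the solutions of the previous
phases, and `c` passes have been completed. -/
structure MSMMatroid.IsState (P : MSMMatroid N) (T : ℕ) (μ : Memory N) (B : List N)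
    (slots : List (List N)) (c : ℕ) : Prop where
  elems : μ.elems = B ++ slots.flatten
  count_true : μ.bits.count true = B.length
  count_false : μ.bits.count false = c
  nodup : B.Nodup
  indep : P.M.Indep (B.toFinset : Set N)
  slots_indep : ∀ s ∈ slots, s.Nodup ∧ P.M.Indep (s.toFinset : Set N)
  slots_length : slots.length = c / T

lemma MSMMatroid.length_le_rank {B : List N} (hB : B.Nodup)
    (hi : P.M.Indep (B.toFinset : Set N)) : B.length ≤ P.rank := by
  have h := hi.encard_le_eRank
  rw [Set.encard_coe_eq_coe_finsetCard, List.toFinset_card_of_nodup hB] at h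
  have htop : P.M.eRank ≠ ⊤ := by
    refine ne_top_of_le_ne_top (b := (Set.univ : Set N).encard) ?_ ?_
    · exact Set.encard_ne_top_iff.2 Set.finite_univ
    · rw [← P.ground, ← P.M.eRk_ground]; exact P.M.eRk_le_encard _
  unfold MSMMatroid.rank
  rw [← ENat.natCast_toNat htop] at h
  exact_mod_cast h

lemma MSMMatroid.IsState.elems_length_le {T c : ℕ} {μ : Memory N} {B : List N}
    {slots : List (List N)} (h : P.IsState T μ B slots c) :
    μ.elems.length ≤ (c / T + 1) * P.rank := by
  have hs : (slots.map List.length).sum ≤ slots.length * P.rank := by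
    have := List.sum_le_card_nsmul (slots.map List.length) P.rank (by
      intro x hx
      obtain ⟨s, hs, rfl⟩ := List.mem_map.1 hx
      exact MSMMatroid.length_le_rank (h.slots_indep s hs).1 (h.slots_indep s hs).2)
    simpa using this
  have hB := MSMMatroid.length_le_rank h.nodup h.indep
  rw [h.elems, List.length_append, List.length_flatten, ← h.slots_length, add_mul]
  linarith

lemma MSMMatroid.IsState.bits_length_le {T c : ℕ} {μ : Memory N} {B : List N}
    {slots : List (List N)} (h : P.IsState T μ B slots c) : μ.bits.length ≤ P.rank + c := by
  have := MSMMatroid.length_le_rank h.nodup h.indep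
  have h1 := h.count_true
  have h2 := h.count_false
  have h3 := List.count_false_add_count_true μ.bits
  omega

/-- The two properties of `B'` are left as hypotheses because `PassState.step` supplies them. -/
lemma MSMMatroid.IsState.step_some {p : ℝ} (hp : 0 ≤ p) {T passes c : ℕ} {μ : Memory N}
    {B : List N} {slots : List (List N)} (h : P.IsState T μ B slots c) (u : N) :
    ∃ B', ExchangeStep P.M p p (sampled p slots.flatten P.f) B u B' ∧
      (B'.Nodup → P.M.Indep (B'.toFinset : Set N) →
        P.IsState T ((exchangeAlgorithm p T passes).step P μ (some u)) B' slots c) := by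
  have hD : ((List.finRange μ.elems.length).map Fin.succ).map (u :: μ.elems).get =
      B ++ slots.flatten := by
    rw [List.map_map, ← h.elems]
    refine List.ext_getElem (by simp) fun i h1 h2 => by simp
  have hpres : (∃ j ∈ ((List.finRange μ.elems.length).map Fin.succ).take (μ.bits.count true),
      (P.view (u :: μ.elems)).same 0 j) ↔ (u :: μ.elems).get 0 ∈ B := by
    have htake : (((List.finRange μ.elems.length).map Fin.succ).take B.length).map
        (u :: μ.elems).get = B := by
      rw [List.map_take, hD, List.take_left]
    rw [h.count_true]
    constructor
    · rintro ⟨j, hj, hsame⟩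
      rw [← htake]
      exact List.mem_map.2 ⟨j, hj, Eq.symm hsame⟩
    · intro hu
      rw [← htake] at hu
      obtain ⟨j, hj, hsame⟩ := List.mem_map.1 hu
      exact ⟨j, hj, hsame.symm⟩
  obtain ⟨B', hstep, h1, h2⟩ := exchange_spec (M := P.M) (f := P.f) hp (u :: μ.elems).get hD
    h.nodup 0 hpres
  refine ⟨B', hstep, fun hnd hi => ?_⟩
  rw [← h.count_true] at h1 h2
  exact
    { elems := h2
      count_true := (count_true_replicate_append _ _).trans h1
      count_false := (count_false_replicate_append _ _).trans h.count_false
      nodup := hnd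
      indep := hi
      slots_indep := h.slots_indep
      slots_length := h.slots_length }

lemma MSMMatroid.IsState.step_none {p : ℝ} {T passes c : ℕ} {μ : Memory N}
    {B : List N} {slots : List (List N)} (h : P.IsState T μ B slots c) :
    P.IsState T ((exchangeAlgorithm p T passes).step P μ none) (if T ∣ c + 1 then [] else B)
      (if T ∣ c + 1 then B :: slots else slots) (c + 1) := by
  have hmap : (List.finRange μ.elems.length).map μ.elems.get = μ.elems := by simp
  constructor
  · refine hmap.trans ?_
    split_ifs <;> simp [h.elems]
  · refine (count_true_replicate_append _ _).trans ?_
    rw [h.count_false, h.count_true]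
    split_ifs <;> rfl
  · exact (count_false_replicate_append _ _).trans (by rw [h.count_false])
  · split_ifs
    · exact List.nodup_nil
    · exact h.nodup
  · split_ifs
    · simp
    · exact h.indep
  · split_ifs
    · intro s hs
      rcases List.mem_cons.1 hs with rfl | hs
      · exact ⟨h.nodup, h.indep⟩
      · exact h.slots_indep s hs
    · exact h.slots_indep
  · split_ifs with hT
    · rw [Nat.succ_div_of_dvd hT, List.length_cons, h.slots_length]
    · rw [Nat.succ_div_of_not_dvd hT, h.slots_length]

/-- Reading the elements of `l`. -/
lemma PassState.foldl_step {p : ℝ} (hp0 : 0 < p) (hp1 : p ≤ 1) {T passes c : ℕ}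
    {slots : List (List N)} {B₀ : List N} (l : List N) {μ : Memory N} {B A : List N}
    {seen : Set N} (h : P.IsState T μ B slots c)
    (hs : PassState P.M p p (sampled p slots.flatten P.f) B₀ seen B A) :
    ∃ B' A', P.IsState T ((l.map some).foldl ((exchangeAlgorithm p T passes).step P) μ) B' slots c ∧
      PassState P.M p p (sampled p slots.flatten P.f) B₀ (seen ∪ {u | u ∈ l}) B' A' := by
  induction l generalizing μ B A seen with
  | nil => exact ⟨B, A, h, by simpa using hs⟩
  | cons u l ih =>
    obtain ⟨B₁, hstep, hst⟩ := h.step_some (passes := passes) hp0.le u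
    obtain ⟨A₁, hs₁⟩ := hs.step (P.isMonoSub.after_sampled hp0.le hp1 _) hp0 hp1 hp0 P.ground hstep
    obtain ⟨B', A', h1, h2⟩ := ih (hst hs₁.nodup hs₁.indep) hs₁
    refine ⟨B', A', h1, ?_⟩
    convert h2 using 1
    ext v; simp; tauto

lemma MSMMatroid.isState_init (P : MSMMatroid N) (T : ℕ) : P.IsState T ⟨[], []⟩ [] [] 0 where
  elems := rfl
  count_true := rfl
  count_false := rfl
  nodup := List.nodup_nil
  indep := by simp
  slots_indep := by simp
  slots_length := by simp

/-- The reads are arbitrary, so the space bounds hold in the middle of a pass too. Each single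
element is treated as a pass of its own. -/
lemma MSMMatroid.exists_isState {p : ℝ} (hp0 : 0 < p) (hp1 : p ≤ 1) {T passes c : ℕ}
    (ρ : List (Option N)) {μ : Memory N} {B : List N} {slots : List (List N)}
    (h : P.IsState T μ B slots c) :
    ∃ B' slots', P.IsState T (ρ.foldl ((exchangeAlgorithm p T passes).step P) μ) B' slots'
      (c + ρ.count none) := by
  induction ρ generalizing μ B slots c with
  | nil => exact ⟨B, slots, h⟩
  | cons r ρ ih =>
    cases r with
    | none =>
      obtain ⟨B', s', h'⟩ := ih (h.step_none (p := p) (passes := passes))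
      refine ⟨B', s', ?_⟩
      rw [List.count_cons_self]
      rwa [Nat.add_right_comm, Nat.add_assoc] at h'
    | some u =>
      obtain ⟨B₁, A₁, h₁, -⟩ := PassState.foldl_step (passes := passes) hp0 hp1 [u] h
        (PassState.start h.nodup h.indep)
      obtain ⟨B', s', h'⟩ := ih h₁
      refine ⟨B', s', ?_⟩
      rw [List.count_cons_of_ne (by simp)]
      exact h'

lemma exchangeAlgorithm_memoryAt {p : ℝ} (hp0 : 0 < p) (hp1 : p ≤ 1) (T passes : ℕ)
    (P : MSMMatroid N) (σ : List N) (t : ℕ) :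
    ∃ c ≤ passes, ∃ B slots,
      P.IsState T ((exchangeAlgorithm p T passes).memoryAt P σ t) B slots c := by
  obtain ⟨B, slots, h⟩ := MSMMatroid.exists_isState (passes := passes) hp0 hp1
    (((exchangeAlgorithm p T passes).reads σ).take t) (P.isState_init T)
  exact ⟨_, (zero_add _).trans_le ((exchangeAlgorithm p T passes).count_none_reads_le σ t),
    B, slots, h⟩

lemma exchangeAlgorithm_result (p : ℝ) (T passes : ℕ) (P : MSMMatroid N) (σ : List N) :
    P.M.Indep ((exchangeAlgorithm p T passes).result P σ : Set N) ∧
      ∀ S : Finset N, P.M.Indep (S : Set N) →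
        (∀ u ∈ S, u ∈ ((exchangeAlgorithm p T passes).finalMemory P σ).elems) →
        P.f S ≤ P.f ((exchangeAlgorithm p T passes).result P σ) := by
  classical
  set D := ((exchangeAlgorithm p T passes).finalMemory P σ).elems with hD
  have hex : ∃ I, (P.view D).indep I ∧ ∀ J, (P.view D).indep J → (P.view D).value J ≤
      (P.view D).value I := by
    obtain ⟨I, hI, hmax⟩ := (Finset.univ.filter (P.view D).indep).exists_max_image
      (P.view D).value ⟨∅, by simp [MSMMatroid.view, elemsAt]⟩
    simp only [Finset.mem_filter, Finset.mem_univ, true_and] at hI hmax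
    exact ⟨I, hI, hmax⟩
  have hres : (exchangeAlgorithm p T passes).result P σ = elemsAt D hex.choose :=
    congrArg (elemsAt D) (dif_pos hex)
  obtain ⟨h1, h2⟩ := hex.choose_spec
  rw [hres]
  refine ⟨h1, fun S hS hSD => ?_⟩
  have himage : elemsAt D (Finset.univ.filter fun j => D.get j ∈ S) = S := by
    ext u
    simp only [elemsAt, Finset.mem_image, Finset.mem_filter, Finset.mem_univ, true_and]
    constructor
    · rintro ⟨j, hj, rfl⟩; exact hj
    · intro hu
      obtain ⟨j, hj⟩ := List.get_of_mem (hSD u hu)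
      exact ⟨j, by rwa [hj], hj⟩
  have := h2 (Finset.univ.filter fun j => D.get j ∈ S) (by
    simpa only [MSMMatroid.view, himage] using hS)
  simpa only [MSMMatroid.view, himage] using this

end Run

/-! ### Analysis -/

section Analysis

variable {N : Type*} [Fintype N] [DecidableEq N] {P : MSMMatroid N}

/-- What is known about the values of the solutions when `c` passes have been completed, in terms
of the value `v` of some feasible set: by how much the previous phases have reduced the distance to
`(1 - p) * v`, and that the current phase has either made its share of progress already, or gained
at least `p ^ 2 * v` in each of its passes. -/
structure MSMMatroid.Progress (P : MSMMatroid N) (p v : ℝ) (T : ℕ) (B : List N)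
    (slots : List (List N)) (c : ℕ) : Prop where
  phases : (1 - p) * v - sampled p slots.flatten P.f ∅ ≤
    ((1 + p) / (1 + 2 * p)) ^ slots.length * v
  phase : p * ((1 - p) * v - sampled p (B ++ slots.flatten) P.f ∅) ≤
      (1 + p) * (sampled p (B ++ slots.flatten) P.f ∅ - sampled p slots.flatten P.f ∅) ∨
    (c - T * slots.length : ℝ) * (p ^ 2 * v) ≤ sampled p (B ++ slots.flatten) P.f ∅

lemma MSMMatroid.sampled_nonneg (P : MSMMatroid N) {p : ℝ} (hp0 : 0 ≤ p) (hp1 : p ≤ 1)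
    (l : List N) : 0 ≤ sampled p l P.f ∅ :=
  (P.nonneg ∅).trans (P.isMonoSub.le_sampled hp0 hp1 l ∅)

lemma MSMMatroid.progress_init (P : MSMMatroid N) {p : ℝ} (hp0 : 0 < p) {v : ℝ} (hv : 0 ≤ v)
    (T : ℕ) : P.Progress p v T [] [] 0 where
  phases := by
    have := P.nonneg ∅
    have := mul_nonneg hp0.le hv
    simp; linarith
  phase := Or.inr (by simpa using P.nonneg ∅)

/-- A pass makes progress in the current phase. -/
lemma PassState.phase {p : ℝ} (hp0 : 0 < p) (hp1 : p ≤ 1) {O : Finset N}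
    (hO : P.M.Indep (O : Set N)) {slots : List (List N)} {B₀ B A : List N}
    (h : PassState P.M p p (sampled p slots.flatten P.f) B₀ Set.univ B A) {x : ℝ}
    (h₀ : p * ((1 - p) * P.f O - sampled p (B₀ ++ slots.flatten) P.f ∅) ≤
        (1 + p) * (sampled p (B₀ ++ slots.flatten) P.f ∅ - sampled p slots.flatten P.f ∅) ∨
      x * (p ^ 2 * P.f O) ≤ sampled p (B₀ ++ slots.flatten) P.f ∅) :
    p * ((1 - p) * P.f O - sampled p (B ++ slots.flatten) P.f ∅) ≤
        (1 + p) * (sampled p (B ++ slots.flatten) P.f ∅ - sampled p slots.flatten P.f ∅) ∨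
      (x + 1) * (p ^ 2 * P.f O) ≤ sampled p (B ++ slots.flatten) P.f ∅ := by
  have hF := P.isMonoSub.after_sampled hp0.le hp1 slots.flatten
  have hle := h.le
  have hfO := P.isMonoSub.le_sampled hp0.le hp1 slots.flatten O
  have hmain := hfO.trans (h.le_of_indep hF hp0 hp1 hp0 hO)
  rw [sampled_append] at h₀
  rw [sampled_append]
  set V₀ := sampled p B₀ (sampled p slots.flatten P.f) ∅
  set V := sampled p B (sampled p slots.flatten P.f) ∅
  set W := sampled p slots.flatten P.f ∅
  rcases h₀ with h₀ | h₀
  -- This alternative persists because the value never drops.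
  · left
    have := mul_le_mul_of_nonneg_left hle hp0.le
    have := mul_le_mul_of_nonneg_left hle (by linarith : 0 ≤ 1 + p)
    linarith
  -- A pass that gains little makes the comparison with `O` sharp enough for the whole phase; any
  -- other pass pays `p ^ 2 * P.f O`.
  · by_cases hg : V - V₀ ≤ p ^ 2 * P.f O
    · left
      have h1 := mul_le_mul_of_nonneg_left hmain hp0.le
      have h2 : p * (V₀ + (1 + p) / p * (V - V₀) + (1 + p) / p * (V - W)) =
          p * V + (V - V₀) + (1 + p) * (V - W) := by
        field_simp; ring
      rw [h2] at h1
      nlinarith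
    · right
      push Not at hg
      linarith

/-- When a phase ends, gains in all its passes would bring the value up to `P.f O`, since `T * p ^
2` is at least `1`; so the progress inequality holds in either case. It says that `1 + 2 * p` times
the new distance to `(1 - p) * P.f O` is at most `1 + p` times the old one. -/
lemma MSMMatroid.Progress.next {p : ℝ} (hp0 : 0 < p) (hp1 : p ≤ 1) {T : ℕ}
    (hTp : 1 ≤ T * p ^ 2) {O : Finset N} (hO : P.M.Indep (O : Set N)) {c : ℕ} {B₀ B A : List N}
    {slots : List (List N)} (hlen : slots.length = c / T)
    (hP : P.Progress p (P.f O) T B₀ slots c)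
    (h : PassState P.M p p (sampled p slots.flatten P.f) B₀ Set.univ B A) :
    P.Progress p (P.f O) T (if T ∣ c + 1 then [] else B)
      (if T ∣ c + 1 then B :: slots else slots) (c + 1 : ℕ) := by
  have hphase := h.phase hp0 hp1 hO hP.phase
  split_ifs with hdvd
  · have hVW : sampled p slots.flatten P.f ∅ ≤ sampled p (B ++ slots.flatten) P.f ∅ := by
      rw [sampled_append]
      exact (P.isMonoSub.after_sampled hp0.le hp1 _).le_sampled hp0.le hp1 B ∅
    have hc : c + 1 = T * (slots.length + 1) := by
      rw [hlen, ← Nat.succ_div_of_dvd hdvd, Nat.mul_div_cancel' hdvd]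
    have hcR : (c : ℝ) + 1 = T * (slots.length + 1) := by exact_mod_cast hc
    have hprog : p * ((1 - p) * P.f O - sampled p (B ++ slots.flatten) P.f ∅) ≤
        (1 + p) * (sampled p (B ++ slots.flatten) P.f ∅ - sampled p slots.flatten P.f ∅) := by
      rcases hphase with h1 | h1
      · exact h1
      · have h2 : (c - T * slots.length : ℝ) + 1 = T := by linarith
        rw [h2] at h1
        have h3 := mul_le_mul_of_nonneg_right hTp (P.nonneg O)
        have h4 : P.f O ≤ sampled p (B ++ slots.flatten) P.f ∅ := by linarith
        have h5 := mul_nonneg (by linarith : 0 ≤ 1 + p) (sub_nonneg.2 hVW)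
        have h6 := mul_nonneg hp0.le (P.nonneg O)
        have h7 : p * ((1 - p) * P.f O - sampled p (B ++ slots.flatten) P.f ∅) ≤ 0 :=
          mul_nonpos_of_nonneg_of_nonpos hp0.le (by linarith)
        linarith
    refine ⟨?_, Or.inr ?_⟩
    · rw [List.flatten_cons, List.length_cons, pow_succ]
      have h1 := mul_le_mul_of_nonneg_left hP.phases
        (by positivity : 0 ≤ (1 + p) / (1 + 2 * p))
      refine le_trans ?_ (h1.trans (le_of_eq (by ring)))
      rw [div_mul_eq_mul_div, le_div_iff₀ (by linarith)]
      linarith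
    · have h0 : (((c + 1 : ℕ) : ℝ) - T * ((B :: slots).length : ℕ)) = 0 := by
        rw [List.length_cons]; push_cast; linarith
      rw [h0, zero_mul]
      exact P.sampled_nonneg hp0.le hp1 _
  · refine ⟨hP.phases, hphase.imp_right fun h1 => ?_⟩
    refine le_of_eq_of_le ?_ h1
    push_cast; ring

lemma exchangeAlgorithm_progress {p : ℝ} (hp0 : 0 < p) (hp1 : p ≤ 1) {T passes : ℕ}
    (hTp : 1 ≤ T * p ^ 2) {O : Finset N} (hO : P.M.Indep (O : Set N)) {σ : List N}
    (hσ : IsStream σ) (c : ℕ) :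
    ∃ B slots, (T ∣ c → B = []) ∧ P.Progress p (P.f O) T B slots c ∧
      P.IsState T ((List.replicate c (σ.map some ++ [none])).flatten.foldl
        ((exchangeAlgorithm p T passes).step P) ⟨[], []⟩) B slots c := by
  induction c with
  | zero => exact ⟨[], [], fun _ => rfl, by simpa using P.progress_init hp0 (P.nonneg O) T,
      P.isState_init T⟩
  | succ c ih =>
    obtain ⟨B₀, slots, -, hP, hS⟩ := ih
    obtain ⟨B, A, hS', hpass⟩ := PassState.foldl_step (passes := passes) hp0 hp1 σ hS
      (PassState.start hS.nodup hS.indep)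
    have huniv : (∅ ∪ {u | u ∈ σ} : Set N) = Set.univ := by
      ext u; simp [hσ.2 u]
    rw [huniv] at hpass
    refine ⟨_, _, fun hd => if_pos hd, hP.next hp0 hp1 hTp hO hS.slots_length hpass, ?_⟩
    rw [List.replicate_succ', List.flatten_append, List.foldl_append]
    simpa using hS'.step_none (p := p) (passes := passes)

end Analysis

/-! ### Numerical estimates and the choice of parameters -/

lemma pow_le_exp_neg_one_add {L : ℕ} (hL : 8 ≤ L) :
    ((1 + 1 / (L : ℝ)) / (1 + 2 * (1 / L))) ^ L ≤ 1 / Real.exp 1 + 4 * (1 / L) := by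
  have hL8 : (8 : ℝ) ≤ L := by exact_mod_cast hL
  have hL0 : (0 : ℝ) < L := by linarith
  obtain ⟨p, hp⟩ : ∃ p : ℝ, p = 1 / L := ⟨_, rfl⟩
  have hp0 : 0 < p := by rw [hp]; positivity
  have hp8 : p ≤ 1 / 8 := by rw [hp]; exact one_div_le_one_div_of_le (by norm_num) hL8
  have hLp : L * p = 1 := by rw [hp]; field_simp
  rw [← hp]
  have h1 : (1 + p) / (1 + 2 * p) ≤ Real.exp (-(p / (1 + 2 * p))) := by
    refine le_trans (le_of_eq ?_) (Real.add_one_le_exp _)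
    field_simp; ring
  have h2 : ((1 + p) / (1 + 2 * p)) ^ L ≤ Real.exp (-1 + 2 * p) := by
    refine (pow_le_pow_left₀ (by positivity) h1 L).trans ?_
    rw [← Real.exp_nat_mul]
    refine Real.exp_le_exp.2 ?_
    have h3 : (L : ℝ) * -(p / (1 + 2 * p)) = -(1 / (1 + 2 * p)) := by
      rw [mul_neg, ← mul_div_assoc, hLp]
    rw [h3]
    have h4 : 1 - 2 * p ≤ 1 / (1 + 2 * p) := by
      rw [le_div_iff₀ (by linarith)]; nlinarith
    linarith
  refine h2.trans ?_
  rw [Real.exp_add, Real.exp_neg, ← one_div]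
  -- The product of `Real.exp (2 * p)` and `1 - 2 * p` is at most `1`, and `(1 + 4 * p) * (1 - 2 *
  -- p)` is at least `1` for `p` up to `1 / 4`.
  have h5 : Real.exp (2 * p) ≤ 1 + 4 * p := by
    have h6 := Real.add_one_le_exp (-(2 * p))
    have h7 : Real.exp (2 * p) * Real.exp (-(2 * p)) = 1 := by rw [← Real.exp_add]; simp
    have h8 := mul_le_mul_of_nonneg_left h6 (Real.exp_pos (2 * p)).le
    rw [h7] at h8
    have h9 := Real.exp_pos (2 * p)
    by_contra hcon
    push Not at hcon
    nlinarith
  have h10 : 1 / Real.exp 1 ≤ 1 := (div_le_one (Real.exp_pos 1)).2 (Real.one_le_exp (by norm_num))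
  have h11 : 0 ≤ 1 / Real.exp 1 := by positivity
  calc 1 / Real.exp 1 * Real.exp (2 * p) ≤ 1 / Real.exp 1 * (1 + 4 * p) :=
        mul_le_mul_of_nonneg_left h5 h11
    _ ≤ 1 / Real.exp 1 + 4 * p := by nlinarith

/-- With `L` phases of `L ^ 2` passes, the approximation ratio is `1 - 1 / e - 5 / L`. -/
lemma exchangeAlgorithm_approx {N : Type*} [Fintype N] [DecidableEq N] (P : MSMMatroid N)
    {σ : List N} (hσ : IsStream σ) {L : ℕ} (hL : 8 ≤ L) {O : Finset N}
    (hO : P.M.Indep (O : Set N)) :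
    (1 - 1 / Real.exp 1 - 5 * (1 / L)) * P.f O ≤
      P.f ((exchangeAlgorithm (1 / L) (L ^ 2) (L ^ 3)).result P σ) := by
  have hL0 : 0 < L := by omega
  have hLR : (8 : ℝ) ≤ L := by exact_mod_cast hL
  have hp0 : (0 : ℝ) < 1 / L := by positivity
  have hp1 : 1 / (L : ℝ) ≤ 1 := (div_le_one (by positivity)).2 (by linarith)
  obtain ⟨B, slots, hB, hP, hS⟩ := exchangeAlgorithm_progress (passes := L ^ 3) (T := L ^ 2) hp0 hp1
    (le_of_eq (by push_cast; field_simp)) hO hσ (L ^ 3)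
  -- The last pass ends a phase, so all stored elements lie in the `L` finished solutions.
  obtain rfl := hB ⟨L, by ring⟩
  have hlen : slots.length = L := by
    rw [hS.slots_length, show L ^ 3 = L * L ^ 2 by ring, Nat.mul_div_cancel _ (by positivity)]
  have hne : slots ≠ [] := fun h => by simp [h] at hlen; omega
  obtain ⟨S, hSi, hSD, hle⟩ := P.isMonoSub.exists_indep_sampled_le P.M slots hne hS.slots_indep
  have hres := (exchangeAlgorithm_result (1 / L) (L ^ 2) (L ^ 3) P σ).2 S hSi fun u hu => by
    have := List.mem_toFinset.1 (hSD hu)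
    have helems := hS.elems
    rw [List.nil_append] at helems
    exact helems ▸ this
  have hph := hP.phases
  rw [hlen] at hph hle
  -- Of the loss `5 / L`, one part comes from the target `(1 - 1 / L) * P.f O` and four from this
  -- estimate.
  have := mul_le_mul_of_nonneg_right (pow_le_exp_neg_one_add hL) (P.nonneg O)
  linarith

/-- The algorithm that makes no pass and stores nothing. -/
def StreamAlgorithm.idle : StreamAlgorithm where
  passes := 0
  init := []
  onElement _ _ _ := ([], [])
  onPassEnd _ _ _ := ([], [])
  output _ _ _ := ∅

lemma StreamAlgorithm.idle_memoryAt {N : Type*} [Fintype N] [DecidableEq N] (P : MSMMatroid N)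
    (σ : List N) (t : ℕ) : StreamAlgorithm.idle.memoryAt P σ t = ⟨[], []⟩ := by
  simp [StreamAlgorithm.memoryAt, StreamAlgorithm.reads, StreamAlgorithm.idle]

theorem theorem2 :
    ∃ C : ℝ, ∀ ε : ℝ, 0 < ε →
      ∃ A : StreamAlgorithm,
        StreamAlgorithm.IsSemiStreaming.{u} A ∧
        (A.passes : ℝ) ≤ C / ε ^ 3 ∧
        ∀ (N : Type u) [Fintype N] [DecidableEq N] (P : MSMMatroid N) (σ : List N),
          IsStream σ →
            (∀ t : ℕ, ((A.memoryAt P σ t).elems.length : ℝ) ≤ C * P.rank / ε ^ 3) ∧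
            P.IsApprox (1 - 1 / Real.exp 1 - ε) (A.result P σ) := by
  -- `729 = 9 ^ 3`: there are `L ^ 3` passes, with `L` at most `9 / ε`.
  refine ⟨729, fun ε hε => ?_⟩
  -- For `ε` at least `1` the required ratio is negative, and the empty set suffices.
  rcases le_or_gt 1 ε with h1 | h1
  · refine ⟨StreamAlgorithm.idle, ⟨0, 0, fun N _ _ P σ _ t => ?_⟩, ?_, fun N _ _ P σ _ =>
      ⟨fun t => ?_, ?_⟩⟩
    · rw [StreamAlgorithm.idle_memoryAt]; simp [Memory.space]
    · simp only [StreamAlgorithm.idle, Nat.cast_zero]; positivity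
    · rw [StreamAlgorithm.idle_memoryAt]; simp only [List.length_nil, Nat.cast_zero]; positivity
    · have hres : StreamAlgorithm.idle.result P σ = ∅ := rfl
      rw [hres]
      refine ⟨by simp, fun T _ => ?_⟩
      have h2 : 0 < 1 / Real.exp 1 := by positivity
      exact (mul_nonpos_of_nonpos_of_nonneg (by linarith) (P.nonneg T)).trans (P.nonneg ∅)
  -- This makes `L` at least `8`, since `ε < 1`, and `5 / L` at most `ε`.
  · set L := ⌈8 / ε⌉₊ with hLdef
    have hLge : 8 / ε ≤ L := Nat.le_ceil _
    have h8ε : 8 ≤ 8 / ε := by rw [le_div_iff₀ hε]; linarith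
    have h1ε : 1 ≤ 1 / ε := by rw [le_div_iff₀ hε]; linarith
    have hL8 : 8 ≤ L := by exact_mod_cast h8ε.trans hLge
    have hLle : (L : ℝ) ≤ 9 / ε := by
      have h2 := (Nat.ceil_lt_add_one (by positivity : 0 ≤ 8 / ε)).le
      have h3 : 8 / ε + 1 / ε = 9 / ε := by ring
      linarith
    have hL0 : (0 : ℝ) < L := by linarith
    have hp0 : (0 : ℝ) < 1 / L := by positivity
    have hp1 : 1 / (L : ℝ) ≤ 1 := (div_le_one hL0).2 (by linarith)
    have hpε : 8 * (1 / (L : ℝ)) ≤ ε := by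
      rw [mul_one_div, div_le_iff₀ hL0]
      rw [div_le_iff₀ hε] at hLge
      linarith
    have hdiv : ∀ c ≤ L ^ 3, c / L ^ 2 ≤ L := fun c hc =>
      (Nat.div_le_div_right hc).trans (by
        rw [show L ^ 3 = L * L ^ 2 by ring, Nat.mul_div_cancel _ (by positivity)])
    refine ⟨exchangeAlgorithm (1 / L) (L ^ 2) (L ^ 3),
      -- No logarithm is needed: at most `L + 1` solutions, one bit per current element and one per
      -- completed pass.
      ⟨L + 2 + L ^ 3, 0, fun N _ _ P σ _ t => ?_⟩, ?_, fun N _ _ P σ hσ => ⟨fun t => ?_, ?_⟩⟩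
    · obtain ⟨c, hc, B, slots, h⟩ := exchangeAlgorithm_memoryAt hp0 hp1 (L ^ 2) (L ^ 3) P σ t
      have h2 := h.elems_length_le
      have h3 := h.bits_length_le
      have h4 := Nat.mul_le_mul_right P.rank (Nat.add_le_add_right (hdiv c hc) 1)
      rw [Memory.space, pow_zero, mul_one]
      calc _ ≤ (L + 1) * P.rank + (P.rank + L ^ 3) := by omega
        _ ≤ (L + 2 + L ^ 3) * (P.rank + 1) := by
          nlinarith [Nat.zero_le (L ^ 3 * P.rank)]
    · calc (((L ^ 3 : ℕ)) : ℝ) = (L : ℝ) ^ 3 := by push_cast; rfl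
        _ ≤ (9 / ε) ^ 3 := pow_le_pow_left₀ hL0.le hLle 3
        _ = 729 / ε ^ 3 := by rw [div_pow]; norm_num
    · obtain ⟨c, hc, B, slots, h⟩ := exchangeAlgorithm_memoryAt hp0 hp1 (L ^ 2) (L ^ 3) P σ t
      have h2 := h.elems_length_le.trans
        (Nat.mul_le_mul_right P.rank (Nat.add_le_add_right (hdiv c hc) 1))
      have h3 : (((exchangeAlgorithm (1 / L) (L ^ 2) (L ^ 3)).memoryAt P σ t).elems.length : ℝ) ≤
          (L + 1) * P.rank := by exact_mod_cast h2
      -- A generous bound: the number of stored elements is in fact of order `P.rank / ε`.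
      have h4 : (L : ℝ) + 1 ≤ 729 / ε ^ 3 := by
        have h5 : ε ^ 3 ≤ ε := pow_le_of_le_one hε.le h1.le (by norm_num)
        have h6 : (L + 1 : ℝ) ≤ 10 / ε := by
          have : 9 / ε + 1 / ε = 10 / ε := by ring
          linarith
        exact h6.trans (div_le_div₀ (by norm_num) (by norm_num) (by positivity) h5)
      calc _ ≤ ((L : ℝ) + 1) * P.rank := h3
        _ ≤ 729 / ε ^ 3 * P.rank := mul_le_mul_of_nonneg_right h4 (Nat.cast_nonneg _)
        _ = 729 * P.rank / ε ^ 3 := by ring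
    · refine ⟨(exchangeAlgorithm_result _ _ _ P σ).1, fun O hO => ?_⟩
      refine le_trans ?_ (exchangeAlgorithm_approx P hσ hL8 hO)
      exact mul_le_mul_of_nonneg_right (by linarith) (P.nonneg O)
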